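/- **Setting.** Consider the problem: minimize $f(x)$ subject to $g(x)\in\Theta$, where $f:\mathbb R^n\to\mathbb R$, $g:\mathbb R^n\to\mathbb R^m$, and $\Theta\subset\mathbb R^m$ is a convex polyhedron (a finite intersection of closed half-spaces). Put $\Gamma:=\{x\mid g(x)\in\Theta\}$, let $\delta_\Gamma$ be $0$ on $\Gamma$ and $\infty$ elsewhere, and let $\varphi:=f+\delta_\Gamma$. For $\varphi:\mathbb R^n\to(-\infty,\infty]$ and $\varphi(x)<\infty$, let $\widehat\partial\varphi(x):=\{v\mid\liminf_{u\to x}\frac{\varphi(u)-\varphi(x)-\langle v,u-x\rangle}{\|u-x\|}\ge 0\}$, and let $\partial\varphi(x)$ be the set of all limits of $v_k\in\widehat\partial\varphi(x_k)$ with $x_k\to x$ and $\varphi(x_k)\to\varphi(x)$; both sets are empty where $\varphi=\infty$. For a set $\Omega$ let $N_\Omega(x):=\partial\delta_\Omega(x)$, let $T_\Omega(x)$ be the set of all $w$ for which there are $t_k\downarrow0$ and $w_k\to w$ with $x+t_kw_k\in\Omega$, and let $K_\Omega(x,v):=T_\Omega(x)\cap\{v\}^\perp$. The multiplier set is $$\Lambda(x,v):=\{y\in\mathbb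 R^m\mid v=\nabla f(x)+\nabla g(x)^*y,\ y\in N_\Theta(g(x))\}.$$ A function $\varphi$ is *variationally convex* at $\bar x$ for $\bar v\in\partial\varphi(\bar x)$ if there are a convex neighborhood $U\times V$ of $(\bar x,\bar v)$ with $\varphi$ l.s.c. on $U$, an l.s.c. convex function $\psi:\mathbb R^n\to(-\infty,\infty]$ with $\psi\le\varphi$ on $U$, and $\varepsilon>0$ such that, with $U_\varepsilon:=\{x\in U\mid\varphi(x)<\varphi(\bar x)+\varepsilon\}$, $$(U_\varepsilon\times V)\cap\operatorname{gph}\partial\varphi=(U\times V)\cap\operatorname{gph}\partial\psi\quad\text{and}\quad\varphi(x)=\psi(x)\ \text{at the common elements }(x,v).$$ It is *strongly variationally convex* with modulus $\sigma>0$ if moreover $\psi$ can be chosen strongly convex on $U$ with modulus $\sigma$. A point $\bar x$ with $\varphi(\bar x)<\infty$ is a *strong local minimizer* of $\varphi$ with modulus $\sigma>0$ if $\varphi(x)\ge\varphi(\bar x)+\frac\sigma2\|x-\bar x\|^2$ for all $x$ near $\bar x$. It is a *tilt-stable local minimizer* of $\varphi$ with modulus $\kappa$ if for some $\gamma>0$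 the mapping $M_\gamma(v):=\operatorname{argmin}\{\varphi(x)-\langle v,x\rangle\mid\|x-\bar x\|\le\gamma\}$ is single-valued and Lipschitz with constant $\kappa$ on some neighborhood of $0$, and $M_\gamma(0)=\{\bar x\}$. **Theorem.** Let $f$ and $g$ be $\mathcal C^2$-smooth around $\bar x\in\Gamma$, let the first-order condition $\nabla f(\bar x)+\nabla g(\bar x)^*\bar y=0$ hold for some $\bar y\in N_\Theta(g(\bar x))$, and let MSCQ hold at $\bar x$: for some $\kappa>0$, $\operatorname{dist}(x;\Gamma)\le\kappa\operatorname{dist}(g(x);\Theta)$ for all $x$ near $\bar x$. (i) If there are neighborhoods $U$ of $\bar x$ and $V$ of $0$ such that $$\langle\nabla^2f(x)w,w\rangle+\langle w,\nabla^2\langle y,g\rangle(x)w\rangle\ge0$$ for all $x\in U$, $v\in V$, $w\in-K_\Gamma(x,v-\nabla f(x))$ and $y\in\Lambda(x,v)$, then $f+\delta_\Gamma$ is variationally convex at $\bar x$ for $0$. Consequently, $\bar x$ is a local minimizer of the constrained problem. (ii) Let $\sigma>0$. If there are neighborhoods $U$ of $\bar x$ and $V$ of $0$ such that $$\langle\nabla^2f(x)w,w\rangle+\langle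 w,\nabla^2\langle y,g\rangle(x)w\rangle\ge\sigma\|w\|^2$$ for all $x\in U$, $v\in V$, $w\in-K_\Gamma(x,v-\nabla f(x))$ and $y\in\Lambda(x,v)$, then $f+\delta_\Gamma$ is strongly variationally convex at $\bar x$ for $0$ with modulus $\sigma$. Consequently, $\bar x$ is a strong local minimizer of $f+\delta_\Gamma$ with modulus $\sigma$, and it is a tilt-stable local minimizer of $f+\delta_\Gamma$ with modulus $\sigma^{-1}$. -/

import Mathlib

open Filter Topology

noncomputable section

namespace VariationalAnalysis

variable {E F : Type*} [NormedAddCommGroup E] [InnerProductSpace ℝ E]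
  [NormedAddCommGroup F] [InnerProductSpace ℝ F]

/-! ### Subdifferentials and normal cones -/

open Classical in
/-- The indicator function `δ_Ω`: it is `0` on `Ω` and `∞` elsewhere. -/
def indicatorFun (Ω : Set E) (x : E) : EReal := if x ∈ Ω then 0 else ⊤

/-- The Fréchet (regular) subdifferential of an extended-real-valued function. The condition
`liminf_{u → x} (φ u - φ x - ⟪v, u - x⟫) / ‖u - x‖ ≥ 0` is written in its `ε`-form. The set is
empty at points where `φ` is not finite. -/
def regularSubdiff (φ : E → EReal) (x : E) : Set E :=
  {v | φ x ≠ ⊤ ∧ φ x ≠ ⊥ ∧ ∀ ε : ℝ, 0 < ε → ∀ᶠ u in 𝓝 x,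
    φ x + ((inner ℝ v (u - x) - ε * ‖u - x‖ : ℝ) : EReal) ≤ φ u}

/-- The Mordukhovich (limiting) subdifferential: limits of regular subgradients `v_k` at points
`x_k → x` with `φ x_k → φ x`. The set is empty at points where `φ` is not finite. -/
def limitingSubdiff (φ : E → EReal) (x : E) : Set E :=
  {v | φ x ≠ ⊤ ∧ φ x ≠ ⊥ ∧ ∃ (xs vs : ℕ → E),
    Tendsto xs atTop (𝓝 x) ∧ Tendsto (fun k => φ (xs k)) atTop (𝓝 (φ x)) ∧
    Tendsto vs atTop (𝓝 v) ∧ ∀ k, vs k ∈ regularSubdiff φ (xs k)}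

/-- The limiting normal cone `N_Ω(x) = ∂δ_Ω(x)` (empty for `x ∉ Ω`). -/
def normalCone (Ω : Set E) (x : E) : Set E := limitingSubdiff (indicatorFun Ω) x

/-- The Bouligand (contingent) tangent cone: limits `w` of `w_k` with `x + t_k w_k ∈ Ω` for some
`t_k ↓ 0`. -/
def contingentCone (Ω : Set E) (x : E) : Set E :=
  {w | ∃ (t : ℕ → ℝ) (ws : ℕ → E), (∀ k, 0 < t k) ∧ Tendsto t atTop (𝓝 0) ∧
    Tendsto ws atTop (𝓝 w) ∧ ∀ k, x + t k • ws k ∈ Ω}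

/-- The critical cone `K_Ω(x, v) = T_Ω(x) ∩ {v}^⊥`. -/
def criticalCone (Ω : Set E) (x v : E) : Set E :=
  {w | w ∈ contingentCone Ω x ∧ inner ℝ v w = 0}

/-! ### Variational convexity -/

/-- `ψ` satisfies the convexity inequality with modulus `σ` on `U`; `σ = 0` is convexity, `σ > 0`
is strong convexity with modulus `σ`. (For `ψ` with values in `(-∞, ∞]`.) -/
def ConvexOnWithModulus (U : Set E) (σ : ℝ) (ψ : E → EReal) : Prop :=
  ∀ x ∈ U, ∀ y ∈ U, ∀ a b : ℝ, 0 < a → 0 < b → a + b = 1 →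
    ψ (a • x + b • y) + ((a * b * (σ / 2 * ‖x - y‖ ^ 2) : ℝ) : EReal)
      ≤ (a : EReal) * ψ x + (b : EReal) * ψ y

/-- The common form of variational convexity (`σ = 0`) and strong variational convexity with
modulus `σ > 0` of `φ` at `x̄` for `v̄ ∈ ∂φ(x̄)`. All requirements concern `φ` near `x̄` only, and so
does the lower semicontinuity of `φ`. The convex function `ψ` is proper and lower semicontinuous
on the whole space, with values in `(-∞, ∞]`. -/
def VariationallyConvexWithModulus (φ : E → EReal) (xbar vbar : E) (σ : ℝ) : Prop :=
  vbar ∈ limitingSubdiff φ xbar ∧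
  ∃ U ∈ 𝓝 xbar, ∃ V ∈ 𝓝 vbar, Convex ℝ U ∧ Convex ℝ V ∧ LowerSemicontinuousOn φ U ∧
    ∃ ψ : E → EReal, (∀ x, ψ x ≠ ⊥) ∧ LowerSemicontinuous ψ ∧
      ConvexOnWithModulus Set.univ 0 ψ ∧ ConvexOnWithModulus U σ ψ ∧ (∀ x ∈ U, ψ x ≤ φ x) ∧
      ∃ ε : ℝ, 0 < ε ∧
        (∀ x ∈ U, ∀ v ∈ V,
          (φ x < φ xbar + (ε : EReal) ∧ v ∈ limitingSubdiff φ x) ↔ v ∈ limitingSubdiff ψ x) ∧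
        (∀ x ∈ U, ∀ v ∈ V, v ∈ limitingSubdiff ψ x → φ x = ψ x)

/-- Variational convexity of `φ` at `x̄` for `v̄`. -/
def VariationallyConvex (φ : E → EReal) (xbar vbar : E) : Prop :=
  VariationallyConvexWithModulus φ xbar vbar 0

/-- Strong variational convexity of `φ` at `x̄` for `v̄` with modulus `σ > 0`. -/
def StronglyVariationallyConvex (φ : E → EReal) (xbar vbar : E) (σ : ℝ) : Prop :=
  0 < σ ∧ VariationallyConvexWithModulus φ xbar vbar σ

/-! ### Local minimizers -/

/-- `x̄` is a strong local minimizer of `φ` with modulus `σ > 0`. -/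
def IsStrongLocalMinimizer (φ : E → EReal) (xbar : E) (σ : ℝ) : Prop :=
  0 < σ ∧ φ xbar ≠ ⊤ ∧
    ∀ᶠ x in 𝓝 xbar, φ xbar + ((σ / 2 * ‖x - xbar‖ ^ 2 : ℝ) : EReal) ≤ φ x

/-- `M_γ(v)`, the set of minimizers of `φ - ⟪v, ·⟫` over the closed ball of radius `γ`. -/
def tiltArgmin (φ : E → EReal) (xbar : E) (γ : ℝ) (v : E) : Set E :=
  {x | x ∈ Metric.closedBall xbar γ ∧ ∀ u ∈ Metric.closedBall xbar γ,
    φ x - ((inner ℝ v x : ℝ) : EReal) ≤ φ u - ((inner ℝ v u : ℝ) : EReal)}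

/-- `x̄` is a tilt-stable local minimizer of `φ` with modulus `κ`: for some `γ > 0` the mapping
`M_γ` is single-valued and `κ`-Lipschitz on a neighborhood of `0`, with `M_γ(0) = {x̄}`. -/
def IsTiltStableLocalMinimizer (φ : E → EReal) (xbar : E) (κ : ℝ) : Prop :=
  0 ≤ κ ∧ φ xbar ≠ ⊤ ∧ ∃ γ : ℝ, 0 < γ ∧ tiltArgmin φ xbar γ 0 = {xbar} ∧
    ∃ V ∈ 𝓝 (0 : E), ∃ m : E → E, (∀ v ∈ V, tiltArgmin φ xbar γ v = {m v}) ∧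
      ∀ v₁ ∈ V, ∀ v₂ ∈ V, ‖m v₁ - m v₂‖ ≤ κ * ‖v₁ - v₂‖

/-! ### The constrained problem: minimize `f x` subject to `g x ∈ Θ` -/

/-- Convex polyhedra: intersections of finitely many closed half-spaces. -/
def IsConvexPolyhedron (Θ : Set F) : Prop :=
  ∃ (p : ℕ) (a : Fin p → F) (b : Fin p → ℝ), Θ = {z | ∀ i, inner ℝ (a i) z ≤ b i}

/-- The feasible set `Γ = {x | g x ∈ Θ}`. -/
def feasibleSet (g : E → F) (Θ : Set F) : Set E := {x | g x ∈ Θ}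

/-- The extended-real-valued cost `f + δ_Γ`. -/
def constrainedCost (f : E → ℝ) (g : E → F) (Θ : Set F) (x : E) : EReal :=
  (f x : EReal) + indicatorFun (feasibleSet g Θ) x

/-- The metric subregularity constraint qualification at the feasible point `x̄`. -/
def MSCQ (g : E → F) (Θ : Set F) (xbar : E) : Prop :=
  xbar ∈ feasibleSet g Θ ∧ ∃ κ : ℝ, 0 < κ ∧ ∀ᶠ x in 𝓝 xbar,
    Metric.infDist x (feasibleSet g Θ) ≤ κ * Metric.infDist (g x) Θ

variable [CompleteSpace E] [CompleteSpace F]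

/-- The multiplier set `Λ(x, v) = {y | v = ∇f(x) + ∇g(x)^* y, y ∈ N_Θ(g x)}`. -/
def multiplierSet (f : E → ℝ) (g : E → F) (Θ : Set F) (x v : E) : Set F :=
  {y | v = gradient f x + (fderiv ℝ g x).adjoint y ∧ y ∈ normalCone Θ (g x)}

/-- The first-order optimality condition at `x̄`: `∇f(x̄) + ∇g(x̄)^* ȳ = 0` for some
`ȳ ∈ N_Θ(g x̄)`. -/
def FirstOrderCondition (f : E → ℝ) (g : E → F) (Θ : Set F) (xbar : E) : Prop :=
  ∃ ybar ∈ normalCone Θ (g xbar), gradient f xbar + (fderiv ℝ g xbar).adjoint ybar = 0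

/-- The Hessian quadratic form `⟪∇²h(x) w, w⟫`. -/
def hessianForm (h : E → ℝ) (x w : E) : ℝ := inner ℝ (fderiv ℝ (gradient h) x w) w

/-- The second-order condition with constant `σ`: on neighborhoods of `x̄` and `0`,
`⟪∇²f(x) w, w⟫ + ⟪w, ∇²⟨y, g⟩(x) w⟫ ≥ σ ‖w‖²` for all `w ∈ -K_Γ(x, v - ∇f(x))` and all
multipliers `y ∈ Λ(x, v)`. -/
def SecondOrderCondition (f : E → ℝ) (g : E → F) (Θ : Set F) (xbar : E) (σ : ℝ) : Prop :=
  ∃ U ∈ 𝓝 xbar, ∃ V ∈ 𝓝 (0 : E), ∀ x ∈ U, ∀ v ∈ V,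
    ∀ w : E, -w ∈ criticalCone (feasibleSet g Θ) x (v - gradient f x) →
      ∀ y ∈ multiplierSet f g Θ x v,
        σ * ‖w‖ ^ 2 ≤ hessianForm f x w + hessianForm (fun z => inner ℝ y (g z)) x w

end VariationalAnalysis

end

/-!
Write `φ = f + δ_Γ`. Under MSCQ every subgradient of `φ` near `(x̄, 0)` has a multiplier of bounded
norm. Hence `φ` is prox-regular at `x̄`, and differentiating `v = ∇f(x) + ∇g(x)^* y` along sequences
in `gph ∂φ`, where the normals `y` enter monotonically, turns the second-order condition into the
bound `⟪q, w⟫ ≥ σ ‖w‖²` for all `q` in the graphical derivative of `∂φ` for the direction `w`.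

By prox-regularity, the localized proximal mapping `P` with parameter `s` is single-valued and
Lipschitz, and the bound makes the gradient `s (z - P z)` of the Moreau envelope increase along
every segment at the rate `σ s / (σ + s)`. So the envelope is strongly convex with that modulus,
which says precisely that the subgradient pairs of `φ` near `(x̄, 0)` generate quadratic minorants
of `φ` with modulus `σ`. The supremum of these minorants is the function `ψ` of variational
convexity; growth at `x̄` and tilt stability can be read off from the minorants.
-/

namespace VariationalAnalysis

section Indicator

variable {E : Type*} {Ω : Set E} {x : E}

theorem indicatorFun_of_mem (hx : x ∈ Ω) : indicatorFun Ω x = 0 := if_pos hx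

theorem indicatorFun_of_notMem (hx : x ∉ Ω) : indicatorFun Ω x = ⊤ := if_neg hx

theorem indicatorFun_ne_bot (Ω : Set E) (x : E) : indicatorFun Ω x ≠ ⊥ := by
  by_cases hx : x ∈ Ω <;> simp [indicatorFun, hx]

theorem coe_le_indicatorFun_iff {c : ℝ} : (c : EReal) ≤ indicatorFun Ω x ↔ (x ∈ Ω → c ≤ 0) := by
  by_cases hx : x ∈ Ω <;> simp [indicatorFun, hx]

end Indicator

section Subgradients

variable {E : Type*} [NormedAddCommGroup E] [InnerProductSpace ℝ E] {φ : E → EReal}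
  {Ω : Set E} {x v : E}

theorem regularSubdiff_subset_limitingSubdiff (φ : E → EReal) (x : E) :
    regularSubdiff φ x ⊆ limitingSubdiff φ x := fun v hv =>
  ⟨hv.1, hv.2.1, fun _ => x, fun _ => v, tendsto_const_nhds, tendsto_const_nhds,
    tendsto_const_nhds, fun _ => hv⟩

theorem mem_regularSubdiff_of_eventually_le {c : ℝ} (htop : φ x ≠ ⊤) (hbot : φ x ≠ ⊥)
    (h : ∀ᶠ u in 𝓝 x, φ x + ((inner ℝ v (u - x) - c * ‖u - x‖ ^ 2 : ℝ) : EReal) ≤ φ u) :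
    v ∈ regularSubdiff φ x := by
  refine ⟨htop, hbot, fun ε hε => ?_⟩
  have hsmall : ∀ᶠ u in 𝓝 x, c * ‖u - x‖ < ε := by
    have hcont : Continuous fun u => c * ‖u - x‖ := by fun_prop
    exact hcont.continuousAt.eventually (gt_mem_nhds (by simpa using hε))
  filter_upwards [h, hsmall] with u hu hcu
  refine le_trans (add_le_add_right (EReal.coe_le_coe_iff.2 ?_) _) hu
  nlinarith [norm_nonneg (u - x)]

theorem mem_regularSubdiff_coe {h : E → ℝ} :
    v ∈ regularSubdiff (fun u => (h u : EReal)) x ↔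
      ∀ ε : ℝ, 0 < ε → ∀ᶠ u in 𝓝 x, h x + (inner ℝ v (u - x) - ε * ‖u - x‖) ≤ h u := by
  simp only [regularSubdiff, Set.mem_ofPred_eq, ne_eq, EReal.coe_ne_top, EReal.coe_ne_bot,
    not_false_eq_true, true_and]
  norm_cast

theorem add_gradient_mem_regularSubdiff [CompleteSpace E] {f : E → ℝ}
    (hf : DifferentiableAt ℝ f x) (hv : v ∈ regularSubdiff φ x) :
    v + gradient f x ∈ regularSubdiff (fun u => (f u : EReal) + φ u) x := by
  obtain ⟨htop, hbot, hreg⟩ := hv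
  refine ⟨EReal.add_ne_top (EReal.coe_ne_top _) htop, by simp [hbot], fun ε hε => ?_⟩
  filter_upwards [hreg (ε / 2) (half_pos hε), hf.hasFDerivAt.isLittleO.def (half_pos hε)]
    with u hφu hfu
  have hfu' : f x + (inner ℝ (gradient f x) (u - x) - ε / 2 * ‖u - x‖) ≤ f u := by
    rw [inner_gradient_left]
    linarith [(abs_le.1 hfu).1]
  calc (f x : EReal) + φ x + ((inner ℝ (v + gradient f x) (u - x) - ε * ‖u - x‖ : ℝ) : EReal)
      = ((f x + (inner ℝ (gradient f x) (u - x) - ε / 2 * ‖u - x‖) : ℝ) : EReal) +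
          (φ x + ((inner ℝ v (u - x) - ε / 2 * ‖u - x‖ : ℝ) : EReal)) := by
        rw [add_comm (f x : EReal), add_assoc, ← EReal.coe_add, add_left_comm, ← EReal.coe_add,
          inner_add_left]
        ring_nf
    _ ≤ (f u : EReal) + φ u := add_le_add (EReal.coe_le_coe_iff.2 hfu') hφu

theorem sub_gradient_mem_regularSubdiff [CompleteSpace E] {f : E → ℝ}
    (hf : DifferentiableAt ℝ f x) (hv : v ∈ regularSubdiff (fun u => (f u : EReal) + φ u) x) :
    v - gradient f x ∈ regularSubdiff φ x := by
  have hneg : gradient (-f) x = -gradient f x := by rw [gradient, fderiv_neg, map_neg, gradient]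
  have hcancel : (fun u => (((-f) u : ℝ) : EReal) + ((f u : EReal) + φ u)) = φ := by
    funext u
    rw [← add_assoc, ← EReal.coe_add]
    simp
  simpa only [hneg, hcancel, sub_eq_add_neg] using add_gradient_mem_regularSubdiff hf.neg hv

theorem mem_regularSubdiff_indicatorFun :
    v ∈ regularSubdiff (indicatorFun Ω) x ↔
      x ∈ Ω ∧ ∀ ε : ℝ, 0 < ε → ∀ᶠ u in 𝓝 x, u ∈ Ω → inner ℝ v (u - x) ≤ ε * ‖u - x‖ := by
  by_cases hx : x ∈ Ω
  · simp only [regularSubdiff, Set.mem_ofPred_eq, indicatorFun_of_mem hx, zero_add,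
      coe_le_indicatorFun_iff, sub_nonpos]
    simp [hx]
  · simp [regularSubdiff, indicatorFun_of_notMem hx, hx]

end Subgradients

section Convex

variable {E : Type*} [NormedAddCommGroup E] [InnerProductSpace ℝ E] {ψ : E → EReal}
  {Ω : Set E} {x v : E}

theorem ConvexOnWithModulus.anti {U U' : Set E} {σ σ' : ℝ} (hψ : ConvexOnWithModulus U σ ψ)
    (hU : U' ⊆ U) (hσ : σ' ≤ σ) : ConvexOnWithModulus U' σ' ψ := by
  intro x hx y hy a b ha hb hab
  refine le_trans (add_le_add_right (EReal.coe_le_coe_iff.2 ?_) _)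
    (hψ x (hU hx) y (hU hy) a b ha hb hab)
  gcongr

theorem convexOnWithModulus_coe {h : E → ℝ} {σ : ℝ} {U : Set E}
    (hh : ∀ x ∈ U, ∀ y ∈ U, ∀ a b : ℝ, 0 < a → 0 < b → a + b = 1 →
      h (a • x + b • y) + a * b * (σ / 2 * ‖x - y‖ ^ 2) ≤ a * h x + b * h y) :
    ConvexOnWithModulus U σ fun x => (h x : EReal) :=
  fun x hx y hy a b ha hb hab => by
    beta_reduce
    exact_mod_cast hh x hx y hy a b ha hb hab

theorem ConvexOnWithModulus.le_of_mem_regularSubdiff (hψ : ConvexOnWithModulus Set.univ 0 ψ)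
    (hbot : ∀ x, ψ x ≠ ⊥) (hv : v ∈ regularSubdiff ψ x) (u : E) :
    ψ x + ((inner ℝ v (u - x) : ℝ) : EReal) ≤ ψ u := by
  by_cases hu : ψ u = ⊤
  · simp [hu]
  obtain ⟨hx, hx', hreg⟩ := hv
  lift ψ x to ℝ using ⟨hx, hx'⟩ with c hc
  lift ψ u to ℝ using ⟨hu, hbot u⟩ with d hd
  have hslope : ∀ ε : ℝ, 0 < ε → c + inner ℝ v (u - x) - d ≤ ε * ‖u - x‖ := by
    intro ε hε
    have hlim : Tendsto (fun t : ℝ => x + t • (u - x)) (𝓝[>] 0) (𝓝 x) := by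
      have hcont : Continuous fun t : ℝ => x + t • (u - x) := by fun_prop
      simpa using (hcont.tendsto 0).mono_left nhdsWithin_le_nhds
    obtain ⟨t, ht, ht0, ht1⟩ :=
      ((hlim.eventually (hreg ε hε)).and (Ioo_mem_nhdsGT one_pos)).exists
    have hconv := hψ x trivial u trivial (1 - t) t (by linarith) ht0 (by ring)
    have hpt : (1 - t) • x + t • u = x + t • (u - x) := by module
    rw [hpt, ← hc, ← hd] at hconv
    simp only [zero_div, zero_mul, mul_zero, EReal.coe_zero, add_zero] at hconv
    have hle : c + (inner ℝ v (t • (u - x)) - ε * ‖t • (u - x)‖) ≤ (1 - t) * c + t * d := by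
      rw [add_sub_cancel_left] at ht
      exact_mod_cast ht.trans hconv
    rw [real_inner_smul_right, norm_smul, Real.norm_eq_abs, abs_of_pos ht0] at hle
    refine le_of_mul_le_mul_left ?_ ht0
    linarith
  have hlim : Tendsto (fun ε : ℝ => ε * ‖u - x‖) (𝓝[>] 0) (𝓝 0) := by
    have hcont : Continuous fun ε : ℝ => ε * ‖u - x‖ := by fun_prop
    simpa using (hcont.tendsto 0).mono_left nhdsWithin_le_nhds
  have hle := ge_of_tendsto hlim (eventually_mem_nhdsWithin.mono hslope)
  exact_mod_cast show c + inner ℝ v (u - x) ≤ d by linarith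

theorem ConvexOnWithModulus.le_of_mem_limitingSubdiff (hψ : ConvexOnWithModulus Set.univ 0 ψ)
    (hbot : ∀ x, ψ x ≠ ⊥) (hv : v ∈ limitingSubdiff ψ x) (u : E) :
    ψ x + ((inner ℝ v (u - x) : ℝ) : EReal) ≤ ψ u := by
  obtain ⟨-, -, xs, vs, hxs, hψxs, hvs, hreg⟩ := hv
  have hinner : Tendsto (fun k => ((inner ℝ (vs k) (u - xs k) : ℝ) : EReal)) atTop
      (𝓝 ((inner ℝ v (u - x) : ℝ) : EReal)) :=
    (continuous_coe_real_ereal.tendsto _).comp (hvs.inner (tendsto_const_nhds.sub hxs))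
  have hadd := (EReal.continuousAt_add (Or.inr (EReal.coe_ne_bot _))
    (Or.inr (EReal.coe_ne_top _))).tendsto.comp (hψxs.prodMk_nhds hinner)
  exact le_of_tendsto hadd (Eventually.of_forall fun k =>
    hψ.le_of_mem_regularSubdiff hbot (hreg k) u)

theorem ConvexOnWithModulus.inner_sub_nonneg (hψ : ConvexOnWithModulus Set.univ 0 ψ)
    (hbot : ∀ x, ψ x ≠ ⊥) {x' v' : E} (hv : v ∈ limitingSubdiff ψ x)
    (hv' : v' ∈ limitingSubdiff ψ x') : 0 ≤ inner ℝ (v - v') (x - x') := by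
  have h₁ := hψ.le_of_mem_limitingSubdiff hbot hv x'
  have h₂ := hψ.le_of_mem_limitingSubdiff hbot hv' x
  lift ψ x to ℝ using ⟨hv.1, hv.2.1⟩ with c
  lift ψ x' to ℝ using ⟨hv'.1, hv'.2.1⟩ with d
  norm_cast at h₁ h₂
  rw [← neg_sub, inner_neg_right] at h₁
  rw [inner_sub_left]
  linarith

theorem convexOnWithModulus_indicatorFun (hΩ : Convex ℝ Ω) :
    ConvexOnWithModulus Set.univ 0 (indicatorFun Ω) := by
  intro x _ y _ a b ha hb hab
  have hmul_ne_bot : ∀ z : E, ∀ c : ℝ, 0 < c → (c : EReal) * indicatorFun Ω z ≠ ⊥ := by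
    intro z c hc
    by_cases hz : z ∈ Ω <;> simp [indicatorFun, hz, EReal.coe_mul_top_of_pos hc]
  by_cases hx : x ∈ Ω
  · by_cases hy : y ∈ Ω
    · simp [indicatorFun_of_mem, hx, hy, hΩ hx hy ha.le hb.le hab]
    · rw [indicatorFun_of_notMem hy, EReal.coe_mul_top_of_pos hb,
        EReal.add_top_of_ne_bot (hmul_ne_bot x a ha)]
      exact le_top
  · rw [indicatorFun_of_notMem hx, EReal.coe_mul_top_of_pos ha,
      EReal.top_add_of_ne_bot (hmul_ne_bot y b hb)]
    exact le_top

theorem mem_normalCone_iff_of_convex (hΩ : Convex ℝ Ω) :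
    v ∈ normalCone Ω x ↔ x ∈ Ω ∧ ∀ z ∈ Ω, inner ℝ v (z - x) ≤ 0 := by
  refine ⟨fun hv => ?_, fun ⟨hx, hle⟩ => ?_⟩
  · have hx : x ∈ Ω := by
      by_contra hx
      exact hv.1 (indicatorFun_of_notMem hx)
    refine ⟨hx, fun z hz => ?_⟩
    have hz' := (convexOnWithModulus_indicatorFun hΩ).le_of_mem_limitingSubdiff
      (indicatorFun_ne_bot Ω) hv z
    simpa [indicatorFun_of_mem, hx, hz] using hz'
  · refine regularSubdiff_subset_limitingSubdiff _ _ (mem_regularSubdiff_indicatorFun.2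
      ⟨hx, fun ε hε => Eventually.of_forall fun z hz => (hle z hz).trans (by positivity)⟩)

theorem mem_normalCone_of_tendsto {ι : Type*} {l : Filter ι} [l.NeBot] {xs vs : ι → E}
    (hΩ : Convex ℝ Ω) (hcl : IsClosed Ω) (hx : Tendsto xs l (𝓝 x)) (hv : Tendsto vs l (𝓝 v))
    (h : ∀ᶠ k in l, vs k ∈ normalCone Ω (xs k)) : v ∈ normalCone Ω x := by
  simp only [mem_normalCone_iff_of_convex hΩ] at h ⊢
  refine ⟨hcl.mem_of_tendsto hx (h.mono fun _ hk => hk.1), fun z hz => ?_⟩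
  exact le_of_tendsto (hv.inner (tendsto_const_nhds.sub hx)) (h.mono fun _ hk => hk.2 z hz)

theorem IsConvexPolyhedron.convex {Θ : Set E} (h : IsConvexPolyhedron Θ) : Convex ℝ Θ := by
  obtain ⟨p, a, b, rfl⟩ := h
  rw [Set.ofPred_forall]
  exact convex_iInter fun i => convex_halfSpace_le (innerₛₗ ℝ (a i)).isLinear (b i)

theorem IsConvexPolyhedron.isClosed {Θ : Set E} (h : IsConvexPolyhedron Θ) : IsClosed Θ := by
  obtain ⟨p, a, b, rfl⟩ := h
  rw [Set.ofPred_forall]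
  exact isClosed_iInter fun i => isClosed_le (by fun_prop) continuous_const

theorem convexOn_infDist {G : Type*} [SeminormedAddCommGroup G] [NormedSpace ℝ G] {S : Set G}
    (hS : Convex ℝ S) : ConvexOn ℝ Set.univ fun z => Metric.infDist z S := by
  obtain rfl | hne := S.eq_empty_or_nonempty
  · simpa using convexOn_const (0 : ℝ) convex_univ
  refine ⟨convex_univ, fun x _ y _ a b ha hb hab => le_of_forall_pos_le_add fun ε hε => ?_⟩
  obtain ⟨p, hp, hxp⟩ := (Metric.infDist_lt_iff hne).1 (lt_add_of_pos_right (Metric.infDist x S) hε)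
  obtain ⟨q, hq, hyq⟩ := (Metric.infDist_lt_iff hne).1 (lt_add_of_pos_right (Metric.infDist y S) hε)
  calc Metric.infDist (a • x + b • y) S
      ≤ dist (a • x + b • y) (a • p + b • q) :=
        Metric.infDist_le_dist_of_mem (hS hp hq ha hb hab)
    _ ≤ dist (a • x) (a • p) + dist (b • y) (b • q) := dist_add_add_le _ _ _ _
    _ = a * dist x p + b * dist y q := by
        rw [dist_smul₀, dist_smul₀, Real.norm_of_nonneg ha, Real.norm_of_nonneg hb]
    _ ≤ a * (Metric.infDist x S + ε) + b * (Metric.infDist y S + ε) := by gcongr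
    _ = a • Metric.infDist x S + b • Metric.infDist y S + ε := by
        rw [smul_eq_mul, smul_eq_mul]; linear_combination ε * hab

end Convex

section Multipliers

variable {E F : Type*} [NormedAddCommGroup E] [InnerProductSpace ℝ E]
  [NormedAddCommGroup F] [InnerProductSpace ℝ F]

theorem mem_regularSubdiff_norm_mul_infDist {Γ : Set E} {x v : E}
    (hv : v ∈ regularSubdiff (indicatorFun Γ) x) :
    v ∈ regularSubdiff (fun u => ((‖v‖ * Metric.infDist u Γ : ℝ) : EReal)) x := by
  obtain ⟨hx, hreg⟩ := mem_regularSubdiff_indicatorFun.1 hv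
  refine mem_regularSubdiff_coe.2 fun ε hε => ?_
  set η := min 1 (ε / (‖v‖ + 3))
  have hη : 0 < η := by positivity
  have hη_le : ‖v‖ * η + 3 * η ≤ ε := by
    rw [← add_mul, ← le_div_iff₀' (by positivity)]
    exact min_le_right _ _
  obtain ⟨ρ, hρ, hball⟩ := Metric.eventually_nhds_iff.1 (hreg η hη)
  filter_upwards [Metric.ball_mem_nhds x (show 0 < ρ / 3 by positivity)] with u hu
  obtain rfl | hux := eq_or_ne u x
  · simp
  have hpos : 0 < ‖u - x‖ := norm_pos_iff.2 (sub_ne_zero.2 hux)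
  obtain ⟨p, hp, hup⟩ := (Metric.infDist_lt_iff ⟨x, hx⟩).1
    (lt_add_of_pos_right (Metric.infDist u Γ) (mul_pos hη hpos))
  rw [dist_eq_norm] at hup
  have hux_le : Metric.infDist u Γ ≤ ‖u - x‖ := by
    simpa [dist_eq_norm] using Metric.infDist_le_dist_of_mem (x := u) hx
  have hpx : ‖p - x‖ ≤ 3 * ‖u - x‖ := by
    have htri := norm_sub_le_norm_sub_add_norm_sub p u x
    rw [norm_sub_rev p u] at htri
    nlinarith [min_le_left 1 (ε / (‖v‖ + 3))]
  have hpx' : inner ℝ v (p - x) ≤ η * ‖p - x‖ := by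
    refine hball ?_ hp
    rw [Metric.mem_ball, dist_eq_norm] at hu
    rw [dist_eq_norm]
    linarith
  have hup' : inner ℝ v (u - p) ≤ ‖v‖ * (Metric.infDist u Γ + η * ‖u - x‖) :=
    (real_inner_le_norm _ _).trans (by gcongr)
  have hsplit : inner ℝ v (u - x) = inner ℝ v (u - p) + inner ℝ v (p - x) := by
    rw [← inner_add_right, sub_add_sub_cancel]
  rw [Metric.infDist_zero_of_mem hx]
  nlinarith [norm_nonneg v]

theorem mem_regularSubdiff_infDist_affine {A : E →L[ℝ] F} {g : E → F} {Θ : Set F} {x v : E}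
    {κ c : ℝ} (hκ : 0 ≤ κ) (hc : 0 ≤ c) (hg : HasFDerivAt g A x) (hx : g x ∈ Θ)
    (hsub : ∀ᶠ u in 𝓝 x, Metric.infDist u (feasibleSet g Θ) ≤ κ * Metric.infDist (g u) Θ)
    (hv : v ∈ regularSubdiff
      (fun u => ((c * Metric.infDist u (feasibleSet g Θ) : ℝ) : EReal)) x) :
    v ∈ regularSubdiff (fun h => ((κ * c * Metric.infDist (g x + A h) Θ : ℝ) : EReal)) 0 := by
  refine mem_regularSubdiff_coe.2 fun ε hε => ?_
  set η := ε / (κ * c + 1)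
  have hη : 0 < η := by positivity
  have hη_le : κ * c * η + η ≤ ε := by
    simp only [η]
    exact le_of_eq (by field_simp)
  have hshift : Tendsto (fun h => x + h) (𝓝 0) (𝓝 x) := by
    simpa using (continuous_const_add x).tendsto 0
  filter_upwards [hshift.eventually (mem_regularSubdiff_coe.1 hv η hη), hshift.eventually hsub,
    hshift.eventually (hg.isLittleO.def hη)] with h hreg hdist hlin
  rw [Metric.infDist_zero_of_mem (show x ∈ feasibleSet g Θ from hx), add_sub_cancel_left] at hreg
  rw [add_sub_cancel_left] at hlin
  have hdist' : Metric.infDist (g (x + h)) Θ ≤ Metric.infDist (g x + A h) Θ + η * ‖h‖ := by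
    refine Metric.infDist_le_infDist_add_dist.trans (add_le_add_right ?_ _)
    rwa [dist_eq_norm, ← sub_sub]
  have hbound : c * Metric.infDist (x + h) (feasibleSet g Θ) ≤
      c * (κ * (Metric.infDist (g x + A h) Θ + η * ‖h‖)) := by
    gcongr
    exact hdist.trans (by gcongr)
  rw [map_zero, add_zero, Metric.infDist_zero_of_mem hx, sub_zero]
  nlinarith [norm_nonneg h]

theorem exists_adjoint_eq_of_inner_le [CompleteSpace E] [CompleteSpace F] {A : E →L[ℝ] F} {v : E}
    {p : F → ℝ} (hp : ConvexOn ℝ Set.univ p) (hcont : Continuous p)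
    (hle : ∀ h, inner ℝ v h ≤ p (A h)) :
    ∃ y, A.adjoint y = v ∧ ∀ z, inner ℝ y z ≤ p z := by
  have hp0 : 0 ≤ p 0 := by simpa using hle 0
  let graph : E →ₗ[ℝ] F × ℝ := A.toLinearMap.prod (innerₛₗ ℝ v)
  have hconv : Convex ℝ {q : F × ℝ | p q.1 < q.2} := by
    simpa using hp.convex_strict_epigraph
  have hdisj : Disjoint {q : F × ℝ | p q.1 < q.2} (LinearMap.range graph : Set (F × ℝ)) := by
    rw [Set.disjoint_right]
    rintro _ ⟨h, rfl⟩ hlt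
    exact (hle h).not_gt hlt
  obtain ⟨ℓ, c, hlt, hge⟩ := geometric_hahn_banach_open hconv
    (isOpen_lt (hcont.comp continuous_fst) continuous_snd) (LinearMap.range graph).convex hdisj
  have hc : c ≤ 0 := by simpa using hge 0 (zero_mem _)
  have hgraph : ∀ h, ℓ (A h, inner ℝ v h) = 0 := by
    intro h
    by_contra hne
    have := hge (graph (((c - 1) / ℓ (A h, inner ℝ v h)) • h)) ⟨_, rfl⟩
    rw [map_smul, map_smul, smul_eq_mul] at this
    change c ≤ (c - 1) / ℓ (A h, inner ℝ v h) * ℓ (A h, inner ℝ v h) at this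
    rw [div_mul_cancel₀ _ hne] at this
    linarith
  set η := (InnerProductSpace.toDual ℝ F).symm (ℓ.comp (ContinuousLinearMap.inl ℝ F ℝ))
  set β := ℓ (0, 1)
  have hℓ : ∀ z s, ℓ (z, s) = inner ℝ η z + s * β := by
    intro z s
    rw [InnerProductSpace.toDual_symm_apply, ContinuousLinearMap.comp_apply,
      ContinuousLinearMap.inl_apply, ← smul_eq_mul, ← map_smul, ← map_add]
    simp
  have hβ : β < 0 := by
    have := hlt (0, p 0 + 1) (by simp)
    rw [hℓ, inner_zero_right] at this
    nlinarith
  refine ⟨(-β)⁻¹ • η, ?_, fun z => le_of_forall_gt fun s hs => ?_⟩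
  · refine ext_inner_right ℝ fun h => ?_
    rw [ContinuousLinearMap.adjoint_inner_left, real_inner_smul_left, inv_mul_eq_iff_eq_mul₀
      (by linarith)]
    linarith [hℓ (A h) (inner ℝ v h), hgraph h]
  · have := hlt (z, s) hs
    rw [hℓ] at this
    rw [real_inner_smul_left, inv_mul_lt_iff₀ (by linarith)]
    linarith

theorem exists_normal_of_mem_regularSubdiff_indicatorFun [CompleteSpace E] [CompleteSpace F]
    {g : E → F} {Θ : Set F} (hΘ : Convex ℝ Θ) {x v : E} {κ : ℝ} (hκ : 0 ≤ κ)
    (hg : DifferentiableAt ℝ g x)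
    (hsub : ∀ᶠ u in 𝓝 x, Metric.infDist u (feasibleSet g Θ) ≤ κ * Metric.infDist (g u) Θ)
    (hv : v ∈ regularSubdiff (indicatorFun (feasibleSet g Θ)) x) :
    ∃ y ∈ normalCone Θ (g x), (fderiv ℝ g x).adjoint y = v ∧ ‖y‖ ≤ κ * ‖v‖ := by
  have hx : g x ∈ Θ := (mem_regularSubdiff_indicatorFun.1 hv).1
  set A := fderiv ℝ g x
  have hconv : ConvexOn ℝ Set.univ fun z => κ * ‖v‖ * Metric.infDist (g x + z) Θ := by
    simpa [Function.comp_def] using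
      ((convexOn_infDist hΘ).translate_right (g x)).smul (by positivity : 0 ≤ κ * ‖v‖)
  have hglobal : ∀ h, inner ℝ v h ≤ κ * ‖v‖ * Metric.infDist (g x + A h) Θ := by
    intro h
    have hmod : ConvexOnWithModulus Set.univ 0
        fun h => ((κ * ‖v‖ * Metric.infDist (g x + A h) Θ : ℝ) : EReal) :=
      convexOnWithModulus_coe fun a _ b _ s t hs ht hst => by
        simpa using hconv.2 (Set.mem_univ (A a)) (Set.mem_univ (A b)) hs.le ht.le hst
    have := hmod.le_of_mem_regularSubdiff (fun _ => EReal.coe_ne_bot _)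
      (mem_regularSubdiff_infDist_affine hκ (norm_nonneg v) hg.hasFDerivAt hx hsub
        (mem_regularSubdiff_norm_mul_infDist hv)) h
    norm_cast at this
    simpa [Metric.infDist_zero_of_mem hx] using this
  obtain ⟨y, hyv, hy⟩ := exists_adjoint_eq_of_inner_le hconv (by fun_prop) hglobal
  refine ⟨y, (mem_normalCone_iff_of_convex hΘ).2 ⟨hx, fun z hz => ?_⟩, hyv, ?_⟩
  · simpa [Metric.infDist_zero_of_mem hz] using hy (z - g x)
  · have hdist : Metric.infDist (g x + y) Θ ≤ ‖y‖ := by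
      simpa using Metric.infDist_le_dist_of_mem (x := g x + y) hx
    have hsq : ‖y‖ * ‖y‖ ≤ κ * ‖v‖ * ‖y‖ := by
      rw [← real_inner_self_eq_norm_mul_norm]
      exact (hy y).trans (by gcongr)
    obtain h0 | hpos := (norm_nonneg y).eq_or_lt
    · rw [← h0]
      positivity
    · exact le_of_mul_le_mul_right hsq hpos

theorem adjoint_mem_regularSubdiff_indicatorFun [CompleteSpace E] [CompleteSpace F] {g : E → F}
    {Θ : Set F} (hΘ : Convex ℝ Θ) {x : E} {y : F} (hg : DifferentiableAt ℝ g x)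
    (hy : y ∈ normalCone Θ (g x)) :
    (fderiv ℝ g x).adjoint y ∈ regularSubdiff (indicatorFun (feasibleSet g Θ)) x := by
  obtain ⟨hx, hle⟩ := (mem_normalCone_iff_of_convex hΘ).1 hy
  refine mem_regularSubdiff_indicatorFun.2 ⟨hx, fun ε hε => ?_⟩
  have hη : 0 < ε / (‖y‖ + 1) := by positivity
  filter_upwards [hg.hasFDerivAt.isLittleO.def hη] with u hlin hu
  rw [ContinuousLinearMap.adjoint_inner_left]
  calc inner ℝ y (fderiv ℝ g x (u - x))
      = inner ℝ y (g u - g x) - inner ℝ y (g u - g x - fderiv ℝ g x (u - x)) := by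
        rw [← inner_sub_right, sub_sub_cancel]
    _ ≤ 0 + ‖y‖ * ‖g u - g x - fderiv ℝ g x (u - x)‖ := by
        linarith [hle _ hu, neg_le_of_abs_le
          (abs_real_inner_le_norm y (g u - g x - fderiv ℝ g x (u - x)))]
    _ ≤ (‖y‖ + 1) * (ε / (‖y‖ + 1) * ‖u - x‖) := by
        rw [zero_add]
        gcongr
        linarith
    _ = ε * ‖u - x‖ := by field_simp

variable [CompleteSpace E] [CompleteSpace F] {f : E → ℝ} {g : E → F} {Θ : Set F} {x v : E}

theorem mem_regularSubdiff_of_mem_multiplierSet (hΘ : Convex ℝ Θ) (hf : DifferentiableAt ℝ f x)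
    (hg : DifferentiableAt ℝ g x) {y : F} (hy : y ∈ multiplierSet f g Θ x v) :
    v ∈ regularSubdiff (constrainedCost f g Θ) x := by
  rw [hy.1, add_comm]
  exact add_gradient_mem_regularSubdiff hf (adjoint_mem_regularSubdiff_indicatorFun hΘ hg hy.2)

theorem exists_multiplier_of_mem_regularSubdiff (hΘ : Convex ℝ Θ) {κ : ℝ} (hκ : 0 ≤ κ)
    (hf : DifferentiableAt ℝ f x) (hg : DifferentiableAt ℝ g x)
    (hsub : ∀ᶠ u in 𝓝 x, Metric.infDist u (feasibleSet g Θ) ≤ κ * Metric.infDist (g u) Θ)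
    (hv : v ∈ regularSubdiff (constrainedCost f g Θ) x) :
    ∃ y ∈ multiplierSet f g Θ x v, ‖y‖ ≤ κ * ‖v - gradient f x‖ := by
  obtain ⟨y, hy, hyv, hnorm⟩ := exists_normal_of_mem_regularSubdiff_indicatorFun hΘ hκ hg hsub
    (sub_gradient_mem_regularSubdiff hf hv)
  exact ⟨y, ⟨by rw [hyv, add_sub_cancel], hy⟩, hnorm⟩

theorem mem_multiplierSet_of_tendsto {ι : Type*} {l : Filter ι} [l.NeBot] {xs vs : ι → E}
    {ys : ι → F} {y : F} (hΘ : Convex ℝ Θ) (hcl : IsClosed Θ) (hf : ContinuousAt (gradient f) x)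
    (hg : ContinuousAt g x) (hg' : ContinuousAt (fderiv ℝ g) x) (hx : Tendsto xs l (𝓝 x))
    (hv : Tendsto vs l (𝓝 v)) (hy : Tendsto ys l (𝓝 y))
    (h : ∀ᶠ k in l, ys k ∈ multiplierSet f g Θ (xs k) (vs k)) : y ∈ multiplierSet f g Θ x v := by
  refine ⟨?_, mem_normalCone_of_tendsto hΘ hcl (hg.tendsto.comp hx) hy (h.mono fun _ hk => hk.2)⟩
  have hadj : Tendsto (fun k => (fderiv ℝ g (xs k)).adjoint) l (𝓝 (fderiv ℝ g x).adjoint) :=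
    (ContinuousLinearMap.adjoint.continuous.tendsto _).comp (hg'.tendsto.comp hx)
  have happly : Continuous fun p : (F →L[ℝ] E) × F => p.1 p.2 :=
    isBoundedBilinearMap_apply.continuous
  have hadj_apply : Tendsto (fun k => (fderiv ℝ g (xs k)).adjoint (ys k)) l
      (𝓝 ((fderiv ℝ g x).adjoint y)) := (happly.tendsto _).comp (hadj.prodMk_nhds hy)
  exact tendsto_nhds_unique_of_eventuallyEq hv ((hf.tendsto.comp hx).add hadj_apply)
    (h.mono fun _ hk => hk.1)

end Multipliers

section Smooth

theorem exists_eventually_taylor_le {E F : Type*} [NormedAddCommGroup E] [NormedSpace ℝ E]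
    [NormedAddCommGroup F] [NormedSpace ℝ F] {h : E → F} {x₀ : E} (hh : ContDiffAt ℝ 2 h x₀) :
    ∃ L : ℝ, 0 ≤ L ∧ ∀ᶠ p : E × E in 𝓝 (x₀, x₀),
      ‖h p.2 - h p.1 - fderiv ℝ h p.1 (p.2 - p.1)‖ ≤ L * ‖p.2 - p.1‖ ^ 2 := by
  obtain ⟨K, s, hs, hK⟩ := (hh.fderiv_right (m := 1) le_rfl).exists_lipschitzOnWith
  have hdiff : ∀ᶠ x in 𝓝 x₀, DifferentiableAt ℝ h x :=
    (hh.eventually (by simp)).mono fun x hx => hx.differentiableAt (by simp)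
  obtain ⟨ρ, hρ, hball⟩ := Metric.eventually_nhds_iff_ball.1 (hdiff.and hs)
  refine ⟨K, K.2, ?_⟩
  filter_upwards [prod_mem_nhds (Metric.ball_mem_nhds x₀ hρ) (Metric.ball_mem_nhds x₀ hρ)]
    with ⟨x, u⟩ ⟨hx, hu⟩
  have hseg : segment ℝ x u ⊆ Metric.ball x₀ ρ := (convex_ball x₀ ρ).segment_subset hx hu
  have hbound : ∀ z ∈ segment ℝ x u, ‖fderiv ℝ h z - fderiv ℝ h x‖ ≤ K * ‖u - x‖ := by
    intro z hz
    rw [← dist_eq_norm]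
    refine (hK.dist_le_mul z (hball z (hseg hz)).2 x (hball x hx).2).trans ?_
    rw [dist_eq_norm]
    gcongr
    exact norm_sub_le_of_mem_segment hz
  refine ((convex_segment x u).norm_image_sub_le_of_norm_hasFDerivWithin_le'
    (fun z hz => (hball z (hseg hz)).1.hasFDerivAt.hasFDerivWithinAt) hbound
    (left_mem_segment ℝ x u) (right_mem_segment ℝ x u)).trans_eq ?_
  rw [mul_assoc, ← sq]

theorem tendsto_inv_smul_sub {E F : Type*} [NormedAddCommGroup E] [NormedSpace ℝ E]
    [NormedAddCommGroup F] [NormedSpace ℝ F] {h : E → F} {x w : E} (hh : DifferentiableAt ℝ h x)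
    {ι : Type*} {l : Filter ι} {t : ι → ℝ} {ws : ι → E} (ht : ∀ k, t k ≠ 0)
    (htlim : Tendsto t l (𝓝 0)) (hw : Tendsto ws l (𝓝 w)) :
    Tendsto (fun k => (t k)⁻¹ • (h (x + t k • ws k) - h x)) l (𝓝 (fderiv ℝ h x w)) := by
  refine hh.hasFDerivAt.hasFDerivWithinAt.lim (s := Set.univ)
    (by simpa using htlim.smul hw) (by simp) (hw.congr fun k => ?_)
  rw [smul_smul, inv_mul_cancel₀ (ht k), one_smul]

theorem tendsto_add_smul {G : Type*} [SeminormedAddCommGroup G] [NormedSpace ℝ G] {ι : Type*}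
    {l : Filter ι} {t : ι → ℝ} {ws : ι → G} {w : G} (x : G) (ht : Tendsto t l (𝓝 0))
    (hw : Tendsto ws l (𝓝 w)) : Tendsto (fun k => x + t k • ws k) l (𝓝 x) := by
  simpa using (ht.smul hw).const_add x

variable {E F : Type*} [NormedAddCommGroup E] [InnerProductSpace ℝ E] [CompleteSpace E]
  [NormedAddCommGroup F] [InnerProductSpace ℝ F] [CompleteSpace F]

theorem gradient_inner_left {g : E → F} {x : E} (hg : DifferentiableAt ℝ g x) (y : F) :
    gradient (fun z => (inner ℝ y (g z) : ℝ)) x = (fderiv ℝ g x).adjoint y := by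
  refine ext_inner_right ℝ fun w => ?_
  rw [inner_gradient_left, ContinuousLinearMap.adjoint_inner_left,
    ((hasFDerivAt_const y x).inner ℝ hg.hasFDerivAt).fderiv]
  simp [fderivInnerCLM_apply]

theorem differentiableAt_gradient {h : E → ℝ} {x : E} (hh : ContDiffAt ℝ 2 h x) :
    DifferentiableAt ℝ (gradient h) x := by
  have hfderiv : DifferentiableAt ℝ (fderiv ℝ h) x :=
    (hh.fderiv_right (m := 1) le_rfl).differentiableAt (by simp)
  -- over `ℝ` the conjugate-linear Riesz isometry is linear
  let riesz : StrongDual ℝ E →L[ℝ] E :=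
    { toFun := (InnerProductSpace.toDual ℝ E).symm
      map_add' := map_add _
      map_smul' := fun c ℓ => by simp
      cont := (InnerProductSpace.toDual ℝ E).symm.continuous }
  exact riesz.differentiableAt.comp x hfderiv

theorem tendsto_hessianForm {h : E → ℝ} {x w : E} (hh : ContDiffAt ℝ 2 h x) {ι : Type*}
    {l : Filter ι} {t : ι → ℝ} {ws : ι → E} (ht : ∀ k, t k ≠ 0) (htlim : Tendsto t l (𝓝 0))
    (hw : Tendsto ws l (𝓝 w)) :
    Tendsto (fun k => (t k)⁻¹ * inner ℝ (gradient h (x + t k • ws k) - gradient h x) (ws k)) l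
      (𝓝 (hessianForm h x w)) := by
  simpa only [real_inner_smul_left, hessianForm] using
    (tendsto_inv_smul_sub (differentiableAt_gradient hh) ht htlim hw).inner (𝕜 := ℝ) hw

end Smooth

section BoundedMultipliers

variable {E F : Type*} [NormedAddCommGroup E] [InnerProductSpace ℝ E] [CompleteSpace E]
  [NormedAddCommGroup F] [InnerProductSpace ℝ F] [FiniteDimensional ℝ F]
  {f : E → ℝ} {g : E → F} {Θ : Set F} {x v : E}

theorem exists_subseq_tendsto_multiplier (hΘ : Convex ℝ Θ) (hcl : IsClosed Θ)
    (hf : ContDiffAt ℝ 2 f x) (hg : ContDiffAt ℝ 2 g x)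
    {xs vs : ℕ → E} {ys : ℕ → F} {C : ℝ} (hx : Tendsto xs atTop (𝓝 x))
    (hv : Tendsto vs atTop (𝓝 v))
    (hy : ∀ᶠ k in atTop, ys k ∈ multiplierSet f g Θ (xs k) (vs k) ∧ ‖ys k‖ ≤ C) :
    ∃ y ∈ multiplierSet f g Θ x v, ‖y‖ ≤ C ∧
      ∃ k : ℕ → ℕ, StrictMono k ∧ Tendsto (ys ∘ k) atTop (𝓝 y) := by
  obtain ⟨y, -, k, hk, hylim⟩ := tendsto_subseq_of_frequently_bounded
    (Metric.isBounded_closedBall (x := (0 : F)) (r := C)) (x := ys)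
    (hy.frequently.mono fun j hj => by simpa using hj.2)
  have hsub := hk.tendsto_atTop.eventually hy
  exact ⟨y, mem_multiplierSet_of_tendsto hΘ hcl (differentiableAt_gradient hf).continuousAt
    hg.continuousAt (hg.fderiv_right (m := 1) le_rfl).continuousAt (hx.comp hk.tendsto_atTop)
    (hv.comp hk.tendsto_atTop) hylim (hsub.mono fun _ hj => hj.1),
    le_of_tendsto hylim.norm (hsub.mono fun _ hj => hj.2), k, hk, hylim⟩

theorem MSCQ.exists_eventually_bounded_multiplier {x₀ : E} (hM : MSCQ g Θ x₀) (hΘ : Convex ℝ Θ)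
    (hcl : IsClosed Θ) (hf : ContDiffAt ℝ 2 f x₀) (hg : ContDiffAt ℝ 2 g x₀) :
    ∃ C : ℝ, 0 ≤ C ∧ ∀ᶠ p : E × E in 𝓝 (x₀, 0),
      p.2 ∈ limitingSubdiff (constrainedCost f g Θ) p.1 →
        ∃ y ∈ multiplierSet f g Θ p.1 p.2, ‖y‖ ≤ C := by
  obtain ⟨-, κ, hκ, hsub⟩ := hM
  have hsmooth := (hf.eventually (by simp)).and (hg.eventually (by simp))
  have hnear : ∀ᶠ p : E × E in 𝓝 (x₀, 0), ‖p.2 - gradient f p.1‖ < ‖gradient f x₀‖ + 1 := by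
    have hcont : ContinuousAt (fun p : E × E => ‖p.2 - gradient f p.1‖) (x₀, 0) :=
      (continuousAt_snd.sub ((differentiableAt_gradient hf).continuousAt.comp'
        continuousAt_fst)).norm
    exact hcont.eventually (gt_mem_nhds (by simp))
  have hregular : ∀ᶠ p : E × E in 𝓝 (x₀, 0),
      p.2 ∈ regularSubdiff (constrainedCost f g Θ) p.1 →
        ∃ y, y ∈ multiplierSet f g Θ p.1 p.2 ∧ ‖y‖ ≤ κ * (‖gradient f x₀‖ + 1) := by
    filter_upwards [(continuousAt_fst (p := ((x₀, 0) : E × E))).eventually hsmooth,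
      (continuousAt_fst (p := ((x₀, 0) : E × E))).eventually (eventually_eventually_nhds.2 hsub),
      hnear] with p ⟨hfp, hgp⟩ hsubp hnearp hp
    obtain ⟨y, hy, hnorm⟩ := exists_multiplier_of_mem_regularSubdiff hΘ hκ.le
      (hfp.differentiableAt (by simp)) (hgp.differentiableAt (by simp)) hsubp hp
    exact ⟨y, hy, hnorm.trans (by gcongr)⟩
  refine ⟨κ * (‖gradient f x₀‖ + 1), by positivity, ?_⟩
  filter_upwards [eventually_eventually_nhds.2 hregular,
    (continuousAt_fst (p := ((x₀, 0) : E × E))).eventually hsmooth] with p hp ⟨hfp, hgp⟩ hmem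
  obtain ⟨-, -, xs, vs, hxs, -, hvs, hreg⟩ := hmem
  obtain ⟨ys, hys⟩ := (((hxs.prodMk_nhds hvs).eventually hp).mono
    fun k hk => hk (hreg k)).choice
  obtain ⟨y, hy, hnorm, -⟩ := exists_subseq_tendsto_multiplier hΘ hcl hfp hgp hxs hvs hys
  exact ⟨y, hy, hnorm⟩

end BoundedMultipliers

section GraphicalDerivative

variable {E F : Type*} [NormedAddCommGroup E] [InnerProductSpace ℝ E]
  [NormedAddCommGroup F] [InnerProductSpace ℝ F]

/-- The graphical derivative `DS(x, v)(w)` of the set-valued map `S` at `x` for `v`: the `q` such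
that `(w, q)` belongs to the contingent cone to the graph of `S` at `(x, v)`. -/
def graphicalDerivative (S : E → Set E) (x v w : E) : Set E :=
  {q | ∃ (t : ℕ → ℝ) (ws qs : ℕ → E), (∀ k, 0 < t k) ∧ Tendsto t atTop (𝓝 0) ∧
    Tendsto ws atTop (𝓝 w) ∧ Tendsto qs atTop (𝓝 q) ∧
    ∀ k, v + t k • qs k ∈ S (x + t k • ws k)}

theorem inner_sub_nonneg_of_mem_normalCone {Ω : Set F} (hΩ : Convex ℝ Ω) {z z' y y' : F}
    (hy : y ∈ normalCone Ω z) (hy' : y' ∈ normalCone Ω z') : 0 ≤ inner ℝ (y - y') (z - z') :=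
  (convexOnWithModulus_indicatorFun hΩ).inner_sub_nonneg (indicatorFun_ne_bot Ω) hy hy'

theorem neg_le_inner_of_mem_normalCone {Θ : Set F} (hΘ : Convex ℝ Θ) {g : E → F} {A : E →L[ℝ] F}
    {x x' : E} {y y' : F} {L : ℝ} (hy : y ∈ normalCone Θ (g x)) (hy' : y' ∈ normalCone Θ (g x'))
    (hA : ‖g x - g x' - A (x - x')‖ ≤ L * ‖x - x'‖ ^ 2) :
    -(‖y' - y‖ * (L * ‖x' - x‖ ^ 2)) ≤ inner ℝ (y' - y) (A (x' - x)) := by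
  have hsplit : A (x' - x) = (g x' - g x) + (g x - g x' - A (x - x')) := by
    rw [← neg_sub x x', map_neg]
    abel
  have hmono := inner_sub_nonneg_of_mem_normalCone hΘ hy' hy
  have hrem := neg_le_of_abs_le (abs_real_inner_le_norm (y' - y) (g x - g x' - A (x - x')))
  have hrem' : ‖y' - y‖ * ‖g x - g x' - A (x - x')‖ ≤ ‖y' - y‖ * (L * ‖x' - x‖ ^ 2) := by
    rw [norm_sub_rev x' x]
    gcongr
  rw [hsplit, inner_add_right]
  linarith

variable [CompleteSpace E] [CompleteSpace F] {f : E → ℝ} {g : E → F} {Θ : Set F} {x v w q : E}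

theorem mem_criticalCone_of_tendsto (hΘ : Convex ℝ Θ) (hg : DifferentiableAt ℝ g x) {y : F}
    (hy : y ∈ normalCone Θ (g x)) {t : ℕ → ℝ} {ws : ℕ → E} {ys : ℕ → F} (ht : ∀ k, 0 < t k)
    (htlim : Tendsto t atTop (𝓝 0)) (hw : Tendsto ws atTop (𝓝 w)) (hylim : Tendsto ys atTop (𝓝 y))
    (hys : ∀ k, ys k ∈ normalCone Θ (g (x + t k • ws k))) :
    w ∈ criticalCone (feasibleSet g Θ) x ((fderiv ℝ g x).adjoint y) := by
  have hquot := tendsto_inv_smul_sub hg (fun k => (ht k).ne') htlim hw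
  simp only [mem_normalCone_iff_of_convex hΘ] at hy hys
  refine ⟨⟨t, ws, ht, htlim, hw, fun k => (hys k).1⟩, ?_⟩
  rw [ContinuousLinearMap.adjoint_inner_left]
  refine le_antisymm (le_of_tendsto (tendsto_const_nhds.inner hquot) ?_)
    (ge_of_tendsto (hylim.inner hquot) ?_)
  · refine Eventually.of_forall fun k => ?_
    rw [real_inner_smul_right]
    exact mul_nonpos_of_nonneg_of_nonpos (inv_nonneg.2 (ht k).le) (hy.2 _ (hys k).1)
  · refine Eventually.of_forall fun k => ?_
    rw [real_inner_smul_right, ← neg_sub, inner_neg_right]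
    exact mul_nonneg (inv_nonneg.2 (ht k).le) (neg_nonneg.2 ((hys k).2 _ hy.1))

theorem le_inner_sub_of_mem_multiplierSet (hΘ : Convex ℝ Θ) {x' v' : E} {y y' : F} {L : ℝ}
    (hy : y ∈ multiplierSet f g Θ x v) (hy' : y' ∈ multiplierSet f g Θ x' v')
    (hg : DifferentiableAt ℝ g x) (hg' : DifferentiableAt ℝ g x')
    (hL : ‖g x - g x' - fderiv ℝ g x' (x - x')‖ ≤ L * ‖x - x'‖ ^ 2) :
    inner ℝ (gradient f x' - gradient f x) (x' - x) +
        inner ℝ (gradient (fun z => (inner ℝ y (g z) : ℝ)) x' -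
          gradient (fun z => (inner ℝ y (g z) : ℝ)) x) (x' - x) -
        ‖y' - y‖ * (L * ‖x' - x‖ ^ 2) ≤ inner ℝ (v' - v) (x' - x) := by
  have hsplit : v' - v = (gradient f x' - gradient f x) +
      ((fderiv ℝ g x').adjoint y - (fderiv ℝ g x).adjoint y) +
      (fderiv ℝ g x').adjoint (y' - y) := by
    rw [hy'.1, hy.1, map_sub]
    abel
  rw [gradient_inner_left hg, gradient_inner_left hg', hsplit, inner_add_left, inner_add_left,
    ContinuousLinearMap.adjoint_inner_left]
  linarith [neg_le_inner_of_mem_normalCone hΘ hy.2 hy'.2 hL]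

theorem hessianForm_add_le_inner_of_tendsto (hΘ : Convex ℝ Θ) (hf : ContDiffAt ℝ 2 f x)
    (hg : ContDiffAt ℝ 2 g x) {y : F} (hy : y ∈ multiplierSet f g Θ x v) {t : ℕ → ℝ}
    {ws qs : ℕ → E} {ys : ℕ → F} (ht : ∀ k, 0 < t k) (htlim : Tendsto t atTop (𝓝 0))
    (hw : Tendsto ws atTop (𝓝 w)) (hq : Tendsto qs atTop (𝓝 q)) (hylim : Tendsto ys atTop (𝓝 y))
    (hys : ∀ k, ys k ∈ multiplierSet f g Θ (x + t k • ws k) (v + t k • qs k)) :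
    hessianForm f x w + hessianForm (fun z => inner ℝ y (g z)) x w ≤ inner ℝ q w := by
  obtain ⟨L, -, hL⟩ := exists_eventually_taylor_le hg
  have hdiff : ∀ᶠ z in 𝓝 x, DifferentiableAt ℝ g z :=
    (hg.eventually (by simp)).mono fun z hz => hz.differentiableAt (by simp)
  have hxlim := tendsto_add_smul x htlim hw
  have hne : ∀ k, t k ≠ 0 := fun k => (ht k).ne'
  have hyg : ContDiffAt ℝ 2 (fun z => (inner ℝ y (g z) : ℝ)) x := contDiffAt_const.inner ℝ hg
  have hlim := ((tendsto_hessianForm hf hne htlim hw).add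
    (tendsto_hessianForm hyg hne htlim hw)).sub
    ((tendsto_iff_norm_sub_tendsto_zero.1 hylim).mul ((hw.norm.pow 2).const_mul L))
  rw [zero_mul, sub_zero] at hlim
  refine le_of_tendsto_of_tendsto hlim (hq.inner hw) ?_
  filter_upwards [hxlim.eventually hdiff, (hxlim.prodMk_nhds tendsto_const_nhds).eventually hL]
    with k hgk hLk
  have hle := le_inner_sub_of_mem_multiplierSet hΘ hy (hys k) hdiff.self_of_nhds hgk hLk
  rw [add_sub_cancel_left, add_sub_cancel_left, norm_smul, Real.norm_of_nonneg (ht k).le] at hle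
  simp only [real_inner_smul_left, real_inner_smul_right] at hle
  refine le_of_mul_le_mul_left ?_ (pow_pos (ht k) 2)
  refine le_trans (le_of_eq ?_) (hle.trans_eq ?_)
  · have := hne k
    field_simp
  · ring

end GraphicalDerivative

section SecondOrderCondition

variable {E F : Type*} [NormedAddCommGroup E] [InnerProductSpace ℝ E] [CompleteSpace E]
  [NormedAddCommGroup F] [InnerProductSpace ℝ F] [FiniteDimensional ℝ F]
  {f : E → ℝ} {g : E → F} {Θ : Set F} {x₀ : E} {σ : ℝ}

theorem SecondOrderCondition.eventually_le_inner (h : SecondOrderCondition f g Θ x₀ σ)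
    (hM : MSCQ g Θ x₀) (hΘ : Convex ℝ Θ) (hcl : IsClosed Θ) (hf : ContDiffAt ℝ 2 f x₀)
    (hg : ContDiffAt ℝ 2 g x₀) :
    ∀ᶠ p : E × E in 𝓝 (x₀, 0), ∀ w,
      ∀ q ∈ graphicalDerivative (limitingSubdiff (constrainedCost f g Θ)) p.1 p.2 w,
        σ * ‖w‖ ^ 2 ≤ inner ℝ q w := by
  obtain ⟨U, hU, V, hV, hsoc⟩ := h
  obtain ⟨C, -, hC⟩ := hM.exists_eventually_bounded_multiplier hΘ hcl hf hg
  have hsmooth := (hf.eventually (by simp)).and (hg.eventually (by simp))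
  filter_upwards [prod_mem_nhds hU hV, eventually_eventually_nhds.2 hC,
    (continuousAt_fst (p := ((x₀, 0) : E × E))).eventually hsmooth]
    with ⟨x, v⟩ ⟨hx, hv⟩ hmult ⟨hfx, hgx⟩ w q ⟨t, ws, qs, ht, htlim, hw, hq, hmem⟩
  have hxlim := tendsto_add_smul x htlim hw
  have hvlim := tendsto_add_smul v htlim hq
  obtain ⟨ys, hys⟩ := (((hxlim.prodMk_nhds hvlim).eventually hmult).mono
    fun k hk => hk (hmem k)).choice
  obtain ⟨y, hy, -, j, hj, hylim⟩ :=
    exists_subseq_tendsto_multiplier hΘ hcl hfx hgx hxlim hvlim hys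
  obtain ⟨N, hN⟩ := eventually_atTop.1 (hj.tendsto_atTop.eventually hys)
  have hjN : Tendsto (fun k => j (k + N)) atTop atTop :=
    hj.tendsto_atTop.comp (tendsto_add_atTop_nat N)
  have hys' := fun k => (hN (k + N) (Nat.le_add_left N k)).1
  have hylim' := hylim.comp (tendsto_add_atTop_nat N)
  have hcrit := mem_criticalCone_of_tendsto hΘ (hgx.differentiableAt (by simp)) hy.2
    (fun k => ht (j (k + N))) (htlim.comp hjN) (hw.comp hjN) hylim' fun k => (hys' k).2
  have hle := hessianForm_add_le_inner_of_tendsto hΘ hfx hgx hy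
    (fun k => ht (j (k + N))) (htlim.comp hjN) (hw.comp hjN) (hq.comp hjN) hylim' hys'
  have hsoc' := hsoc x hx v hv (-w)
    (by rwa [neg_neg, hy.1, add_sub_cancel_left]) y hy
  simp only [hessianForm, map_neg, inner_neg_neg, norm_neg] at hle hsoc'
  exact hsoc'.trans hle

end SecondOrderCondition

section SubgradientInequality

theorem add_coe_le_add_coe_iff {x y : EReal} {a b : ℝ} :
    x + (a : EReal) ≤ y + (b : EReal) ↔ x + ((a - b : ℝ) : EReal) ≤ y := by
  rw [← EReal.sub_le_iff_le_add (.inl (EReal.coe_ne_bot b)) (.inl (EReal.coe_ne_top b)),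
    sub_eq_add_neg, add_assoc, ← EReal.coe_neg, ← EReal.coe_add, sub_eq_add_neg]

theorem exists_add_coe_le_of_isCompact {X : Type*} [TopologicalSpace X] {K : Set X} {φ : X → EReal}
    {h : X → ℝ} (hK : IsCompact K) (hne : K.Nonempty) (hφ : LowerSemicontinuousOn φ K)
    (hh : ContinuousOn h K) : ∃ x ∈ K, ∀ u ∈ K, φ x + (h x : EReal) ≤ φ u + (h u : EReal) :=
  LowerSemicontinuousOn.exists_isMinOn hne hK <|
    hφ.add' (continuous_coe_real_ereal.comp_continuousOn hh).lowerSemicontinuousOn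
      fun _ _ => EReal.continuousAt_add (.inr (EReal.coe_ne_bot _)) (.inr (EReal.coe_ne_top _))

variable {E : Type*} [NormedAddCommGroup E] [InnerProductSpace ℝ E] {φ : E → EReal}
  {x₀ x u v : E} {ρ ρ' σ σ' : ℝ}

/-- The subgradient pairs `(x, v) ∈ gph ∂φ` with `x` and `v` within distance `ρ` of `x₀` and `0`. -/
def localSubdiffGraph (φ : E → EReal) (x₀ : E) (ρ : ℝ) : Set (E × E) :=
  {p | p.1 ∈ Metric.ball x₀ ρ ∧ p.2 ∈ Metric.ball (0 : E) ρ ∧ p.2 ∈ limitingSubdiff φ p.1}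

/-- The subgradients of `φ` near `(x₀, 0)` satisfy a quadratic subgradient inequality of modulus
`σ` on the ball of radius `ρ`. With `σ = -s < 0` this is prox-regularity of `φ` at `x₀` for `0` with
constant `s`; with `σ > 0` it is the uniform quadratic growth that characterizes strong variational
convexity. -/
structure UniformSubgradientInequality (φ : E → EReal) (x₀ : E) (ρ σ : ℝ) : Prop where
  radius_pos : 0 < ρ
  zero_mem : 0 ∈ limitingSubdiff φ x₀
  lowerSemicontinuousAt : ∀ x ∈ Metric.ball x₀ ρ, LowerSemicontinuousAt φ x
  le : ∀ p ∈ localSubdiffGraph φ x₀ ρ, ∀ u ∈ Metric.ball x₀ ρ,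
    φ p.1 + ((inner ℝ p.2 (u - p.1) + σ / 2 * ‖u - p.1‖ ^ 2 : ℝ) : EReal) ≤ φ u

theorem exists_uniformSubgradientInequality_of_eventually (hzero : 0 ∈ limitingSubdiff φ x₀)
    (hlsc : ∀ᶠ x in 𝓝 x₀, LowerSemicontinuousAt φ x)
    (hle : ∀ᶠ q : (E × E) × E in 𝓝 ((x₀, 0), x₀), q.1.2 ∈ limitingSubdiff φ q.1.1 →
      φ q.1.1 + ((inner ℝ q.1.2 (q.2 - q.1.1) + σ / 2 * ‖q.2 - q.1.1‖ ^ 2 : ℝ) : EReal) ≤ φ q.2) :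
    ∃ ρ, UniformSubgradientInequality φ x₀ ρ σ := by
  obtain ⟨ρ₁, hρ₁, hlsc⟩ := Metric.eventually_nhds_iff_ball.1 hlsc
  obtain ⟨ρ₂, hρ₂, hle⟩ := Metric.eventually_nhds_iff_ball.1 hle
  refine ⟨min ρ₁ ρ₂, lt_min hρ₁ hρ₂, hzero,
    fun x hx => hlsc x (Metric.ball_subset_ball (min_le_left _ _) hx),
    fun p ⟨hp₁, hp₂, hp⟩ u hu => hle (p, u) ?_ hp⟩
  simp only [← ball_prod_same, Set.mem_prod]
  have hsub := min_le_right ρ₁ ρ₂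
  exact ⟨⟨Metric.ball_subset_ball hsub hp₁, Metric.ball_subset_ball hsub hp₂⟩,
    Metric.ball_subset_ball hsub hu⟩

namespace UniformSubgradientInequality

theorem mono (H : UniformSubgradientInequality φ x₀ ρ σ) (hpos : 0 < ρ') (hρ : ρ' ≤ ρ)
    (hσ : σ' ≤ σ) : UniformSubgradientInequality φ x₀ ρ' σ' where
  radius_pos := hpos
  zero_mem := H.zero_mem
  lowerSemicontinuousAt x hx := H.lowerSemicontinuousAt x (Metric.ball_subset_ball hρ hx)
  le p hp u hu := by
    refine le_trans (add_le_add_right (EReal.coe_le_coe_iff.2 ?_) _)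
      (H.le p ⟨Metric.ball_subset_ball hρ hp.1, Metric.ball_subset_ball hρ hp.2.1, hp.2.2⟩ u
        (Metric.ball_subset_ball hρ hu))
    gcongr

theorem lowerSemicontinuousOn (H : UniformSubgradientInequality φ x₀ ρ σ) :
    LowerSemicontinuousOn φ (Metric.ball x₀ ρ) :=
  fun x hx => (H.lowerSemicontinuousAt x hx).lowerSemicontinuousWithinAt _

theorem mem_localSubdiffGraph (H : UniformSubgradientInequality φ x₀ ρ σ) :
    (x₀, 0) ∈ localSubdiffGraph φ x₀ ρ :=
  ⟨Metric.mem_ball_self H.radius_pos, Metric.mem_ball_self H.radius_pos, H.zero_mem⟩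

theorem base_add_le (H : UniformSubgradientInequality φ x₀ ρ σ) (hu : u ∈ Metric.ball x₀ ρ) :
    φ x₀ + ((σ / 2 * ‖u - x₀‖ ^ 2 : ℝ) : EReal) ≤ φ u := by
  simpa using H.le _ H.mem_localSubdiffGraph u hu

theorem ne_bot (H : UniformSubgradientInequality φ x₀ ρ σ) (hu : u ∈ Metric.ball x₀ ρ) :
    φ u ≠ ⊥ := by
  have hle := H.base_add_le hu
  lift φ x₀ to ℝ using ⟨H.zero_mem.1, H.zero_mem.2.1⟩ with c
  exact ((EReal.bot_lt_coe _).trans_le hle).ne'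

theorem toReal_add_le (H : UniformSubgradientInequality φ x₀ ρ σ)
    (hxv : (x, v) ∈ localSubdiffGraph φ x₀ ρ) (hu : u ∈ Metric.ball x₀ ρ) (htop : φ u ≠ ⊤) :
    (φ x).toReal + inner ℝ v (u - x) + σ / 2 * ‖u - x‖ ^ 2 ≤ (φ u).toReal := by
  have hle := H.le _ hxv u hu
  rw [← EReal.coe_toReal hxv.2.2.1 hxv.2.2.2.1, ← EReal.coe_toReal htop (H.ne_bot hu)] at hle
  rw [add_assoc]
  exact_mod_cast hle

theorem mul_norm_sq_le_inner (H : UniformSubgradientInequality φ x₀ ρ σ) {x₁ x₂ v₁ v₂ : E}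
    (h₁ : (x₁, v₁) ∈ localSubdiffGraph φ x₀ ρ) (h₂ : (x₂, v₂) ∈ localSubdiffGraph φ x₀ ρ) :
    σ * ‖x₁ - x₂‖ ^ 2 ≤ inner ℝ (v₁ - v₂) (x₁ - x₂) := by
  have hle₁ := H.toReal_add_le h₁ h₂.1 h₂.2.2.1
  have hle₂ := H.toReal_add_le h₂ h₁.1 h₁.2.2.1
  rw [← neg_sub x₁ x₂, inner_neg_right, norm_neg] at hle₁
  rw [inner_sub_left]
  linarith

end UniformSubgradientInequality

end SubgradientInequality

section ConstrainedCost

variable {E F : Type*} {f : E → ℝ} {g : E → F} {Θ : Set F} {x : E}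

theorem constrainedCost_of_mem (hx : g x ∈ Θ) : constrainedCost f g Θ x = f x := by
  rw [constrainedCost, indicatorFun_of_mem (Ω := feasibleSet g Θ) hx, add_zero]

theorem coe_le_constrainedCost_iff {c : ℝ} :
    (c : EReal) ≤ constrainedCost f g Θ x ↔ (g x ∈ Θ → c ≤ f x) := by
  by_cases hx : g x ∈ Θ
  · simp [constrainedCost_of_mem hx, hx]
  · simp [constrainedCost, indicatorFun_of_notMem (Ω := feasibleSet g Θ) hx, hx]

theorem lowerSemicontinuousAt_constrainedCost [TopologicalSpace E] [TopologicalSpace F]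
    (hcl : IsClosed Θ) (hf : ContinuousAt f x) (hg : ContinuousAt g x) :
    LowerSemicontinuousAt (constrainedCost f g Θ) x := by
  intro a ha
  by_cases hx : g x ∈ Θ
  · rw [constrainedCost_of_mem hx] at ha
    filter_upwards [(continuous_coe_real_ereal.continuousAt.comp hf).eventually (lt_mem_nhds ha)]
      with u hu
    exact hu.trans_le (coe_le_constrainedCost_iff.2 fun _ => le_rfl)
  · filter_upwards [hg.eventually (hcl.isOpen_compl.mem_nhds hx)] with u hu
    rw [constrainedCost, indicatorFun_of_notMem (Ω := feasibleSet g Θ) hx, EReal.coe_add_top] at ha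
    rwa [constrainedCost, indicatorFun_of_notMem (Ω := feasibleSet g Θ) hu, EReal.coe_add_top]

end ConstrainedCost

section ProxRegularity

variable {E F : Type*} [NormedAddCommGroup E] [InnerProductSpace ℝ E] [CompleteSpace E]
  [NormedAddCommGroup F] [InnerProductSpace ℝ F] {f : E → ℝ} {g : E → F} {Θ : Set F}

theorem constrainedCost_add_le_of_mem_multiplierSet [CompleteSpace F] (hΘ : Convex ℝ Θ) {x u v : E}
    {y : F} {C L₁ L₂ : ℝ} (hy : y ∈ multiplierSet f g Θ x v) (hC : ‖y‖ ≤ C)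
    (hf : ‖f u - f x - fderiv ℝ f x (u - x)‖ ≤ L₁ * ‖u - x‖ ^ 2)
    (hg : ‖g u - g x - fderiv ℝ g x (u - x)‖ ≤ L₂ * ‖u - x‖ ^ 2) :
    constrainedCost f g Θ x +
      ((inner ℝ v (u - x) - (L₁ + C * L₂) * ‖u - x‖ ^ 2 : ℝ) : EReal) ≤
        constrainedCost f g Θ u := by
  obtain ⟨rfl, hyN⟩ := hy
  rw [mem_normalCone_iff_of_convex hΘ] at hyN
  rw [constrainedCost_of_mem hyN.1, ← EReal.coe_add, coe_le_constrainedCost_iff]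
  intro hu
  have hnormal : inner ℝ y (g u - g x) ≤ 0 := hyN.2 _ hu
  have hrem : inner ℝ y (fderiv ℝ g x (u - x)) - inner ℝ y (g u - g x) ≤
      C * (L₂ * ‖u - x‖ ^ 2) := by
    rw [← inner_sub_right]
    refine (real_inner_le_norm _ _).trans (mul_le_mul hC ?_ (norm_nonneg _) ?_)
    · rwa [norm_sub_rev]
    · exact (norm_nonneg y).trans hC
  have hfrem := neg_le_of_abs_le hf
  rw [inner_add_left, inner_gradient_left, ContinuousLinearMap.adjoint_inner_left]
  linarith

theorem exists_uniformSubgradientInequality_neg [FiniteDimensional ℝ F] {x₀ : E}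
    (hΘ : Convex ℝ Θ) (hcl : IsClosed Θ) (hf : ContDiffAt ℝ 2 f x₀) (hg : ContDiffAt ℝ 2 g x₀)
    (hfirst : FirstOrderCondition f g Θ x₀) (hM : MSCQ g Θ x₀) :
    ∃ s : ℝ, 0 ≤ s ∧ ∃ ρ, UniformSubgradientInequality (constrainedCost f g Θ) x₀ ρ (-s) := by
  obtain ⟨C, hC, hmult⟩ := hM.exists_eventually_bounded_multiplier hΘ hcl hf hg
  obtain ⟨L₁, hL₁, hTf⟩ := exists_eventually_taylor_le hf
  obtain ⟨L₂, hL₂, hTg⟩ := exists_eventually_taylor_le hg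
  obtain ⟨ybar, hybar, hzero⟩ := hfirst
  refine ⟨2 * (L₁ + C * L₂), by positivity,
    exists_uniformSubgradientInequality_of_eventually ?_ ?_ ?_⟩
  · exact regularSubdiff_subset_limitingSubdiff _ _ (mem_regularSubdiff_of_mem_multiplierSet hΘ
      (hf.differentiableAt (by simp)) (hg.differentiableAt (by simp)) ⟨hzero.symm, hybar⟩)
  · filter_upwards [hf.eventually (by simp), hg.eventually (by simp)] with x hfx hgx
    exact lowerSemicontinuousAt_constrainedCost hcl hfx.continuousAt hgx.continuousAt
  · have hpair : Tendsto (fun q : (E × E) × E => (q.1.1, q.2)) (𝓝 ((x₀, 0), x₀))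
        (𝓝 (x₀, x₀)) := (continuous_fst.fst.prodMk continuous_snd).tendsto _
    filter_upwards [(continuous_fst.tendsto ((x₀, (0 : E)), x₀)).eventually hmult,
      hpair.eventually hTf, hpair.eventually hTg] with q hq hfq hgq hv
    obtain ⟨y, hy, hnorm⟩ := hq hv
    convert constrainedCost_add_le_of_mem_multiplierSet hΘ hy hnorm hfq hgq using 3
    ring

end ProxRegularity

section RealFunctions

theorem add_mul_le_of_frequently_lt_slope {k : ℝ → ℝ} {c t : ℝ}
    (hk : ContinuousOn k (Set.Icc 0 1))
    (hslope : ∀ τ ∈ Set.Ico (0 : ℝ) 1, ∀ R < c, ∃ᶠ b in 𝓝[>] τ, R < slope k τ b)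
    (ht : t ∈ Set.Icc (0 : ℝ) 1) : k 0 + c * t ≤ k t := by
  have hneg : -k t ≤ -k 0 - c * t := by
    refine image_le_of_liminf_slope_right_le_deriv_boundary (f := fun τ => -k τ)
      (B := fun τ => -k 0 - c * τ) (B' := fun _ => -c) hk.neg (by simp) (by fun_prop)
      (fun τ _ => ?_) (fun τ hτ R hR => ?_) ht
    · simpa using (((hasDerivAt_id τ).const_mul c).const_sub (-k 0)).hasDerivWithinAt
    · refine (hslope τ hτ (-R) (by linarith)).mono fun b hb => ?_
      rw [slope_neg]
      linarith
  linarith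

theorem le_of_forall_sub_sq_le {G : ℝ → ℝ} {c : ℝ}
    (hG : ∀ a b, 0 ≤ a → a ≤ b → b ≤ 1 → G a - c * (b - a) ^ 2 ≤ G b) : G 0 ≤ G 1 := by
  have hstep (n : ℕ) : G 0 - c * (1 / ((n : ℝ) + 1)) ≤ G 1 := by
    have hn : (0 : ℝ) < n + 1 := by positivity
    have hterm (i : ℕ) (hi : i ∈ Finset.range (n + 1)) :
        -(c * (1 / ((n : ℝ) + 1)) ^ 2) ≤ G ((i + 1 : ℕ) / (n + 1)) - G (i / (n + 1)) := by
      have hi' : ((i + 1 : ℕ) : ℝ) ≤ n + 1 := by exact_mod_cast Finset.mem_range.1 hi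
      have hle := hG (i / (n + 1)) ((i + 1 : ℕ) / (n + 1)) (by positivity) (by gcongr; simp)
        ((div_le_one hn).2 hi')
      rw [← sub_div, Nat.cast_add_one, add_sub_cancel_left] at hle
      push_cast
      linarith
    have hsum := Finset.card_nsmul_le_sum _ _ _ hterm
    rw [Finset.sum_range_sub fun i : ℕ => G ((i : ℝ) / (n + 1)), Finset.card_range, nsmul_eq_mul,
      Nat.cast_add_one, div_self hn.ne', Nat.cast_zero, zero_div] at hsum
    have hscale : ((n : ℝ) + 1) * -(c * (1 / (n + 1)) ^ 2) = -(c * (1 / (n + 1))) := by field_simp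
    linarith
  have hlim : Tendsto (fun n : ℕ => G 0 - c * (1 / ((n : ℝ) + 1))) atTop (𝓝 (G 0 - c * 0)) :=
    tendsto_const_nhds.sub (tendsto_one_div_add_atTop_nhds_zero_nat.const_mul c)
  simpa using le_of_tendsto' hlim hstep

end RealFunctions

section ProximalMap

variable {E : Type*} [NormedAddCommGroup E] [InnerProductSpace ℝ E] {φ : E → EReal}
  {x₀ p x u v y z h : E} {ρ σ s δ : ℝ} {P : E → E}

theorem smul_sub_mem_regularSubdiff (htop : φ p ≠ ⊤) (hbot : φ p ≠ ⊥)
    (hmin : ∀ᶠ u in 𝓝 p, φ p + ((s / 2 * ‖p - z‖ ^ 2 : ℝ) : EReal) ≤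
      φ u + ((s / 2 * ‖u - z‖ ^ 2 : ℝ) : EReal)) : s • (z - p) ∈ regularSubdiff φ p := by
  refine mem_regularSubdiff_of_eventually_le (c := s / 2) htop hbot (hmin.mono fun u hu => ?_)
  rw [add_coe_le_add_coe_iff] at hu
  convert hu using 3
  rw [← sub_add_sub_cancel u p z, norm_add_sq_real, ← neg_sub p z, real_inner_smul_left,
    inner_neg_left, real_inner_comm]
  ring

theorem UniformSubgradientInequality.norm_sub_le_three_mul
    (H : UniformSubgradientInequality φ x₀ ρ (-(s / 4))) (hs : 0 < s) (hp : p ∈ Metric.ball x₀ ρ)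
    (htop : φ p ≠ ⊤) (hle : φ p + ((s / 2 * ‖p - z‖ ^ 2 : ℝ) : EReal) ≤
      φ x₀ + ((s / 2 * ‖x₀ - z‖ ^ 2 : ℝ) : EReal)) : ‖p - x₀‖ ≤ 3 * ‖z - x₀‖ := by
  have hbase := H.base_add_le hp
  have hbot := H.ne_bot hp
  lift φ p to ℝ using ⟨htop, hbot⟩ with a
  lift φ x₀ to ℝ using ⟨H.zero_mem.1, H.zero_mem.2.1⟩ with b
  norm_cast at hle hbase
  have hsq : 4 * ‖p - z‖ ^ 2 ≤ 4 * ‖z - x₀‖ ^ 2 + ‖p - x₀‖ ^ 2 := by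
    rw [norm_sub_rev x₀ z] at hle
    exact le_of_mul_le_mul_left (by linarith) hs
  have htri : ‖p - x₀‖ ≤ ‖p - z‖ + ‖z - x₀‖ := norm_sub_le_norm_sub_add_norm_sub p z x₀
  by_contra! hcon
  nlinarith [norm_nonneg (z - x₀)]

/-- `P` is a localized proximal mapping of `φ`: for `z` within distance `δ` of `x₀`, the point `P z`
minimizes `φ u + s / 2 * ‖u - z‖ ^ 2` over the closed ball of radius `ρ / 2`. It lies in the
interior of that ball, so that the optimality condition `s • (z - P z) ∈ ∂φ (P z)` holds. -/
structure IsLocalProxMap (φ : E → EReal) (x₀ : E) (ρ s δ : ℝ) (P : E → E) : Prop where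
  mem_ball : ∀ z ∈ Metric.ball x₀ δ, P z ∈ Metric.ball x₀ (ρ / 2)
  mem : ∀ z ∈ Metric.ball x₀ δ, (P z, s • (z - P z)) ∈ localSubdiffGraph φ x₀ ρ
  le : ∀ z ∈ Metric.ball x₀ δ, ∀ u ∈ Metric.closedBall x₀ (ρ / 2),
    φ (P z) + ((s / 2 * ‖P z - z‖ ^ 2 : ℝ) : EReal) ≤ φ u + ((s / 2 * ‖u - z‖ ^ 2 : ℝ) : EReal)

theorem UniformSubgradientInequality.exists_isLocalProxMap [FiniteDimensional ℝ E]
    (H : UniformSubgradientInequality φ x₀ ρ (-(s / 4))) (hs : 0 < s) :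
    ∃ δ, 0 < δ ∧ ∃ P, IsLocalProxMap φ x₀ ρ s δ P := by
  have hρ := H.radius_pos
  have hsub : Metric.closedBall x₀ (ρ / 2) ⊆ Metric.ball x₀ ρ :=
    Metric.closedBall_subset_ball (half_lt_self hρ)
  have hx₀ : x₀ ∈ Metric.closedBall x₀ (ρ / 2) := Metric.mem_closedBall_self (by positivity)
  have hmin (z : E) : ∃ p ∈ Metric.closedBall x₀ (ρ / 2), ∀ u ∈ Metric.closedBall x₀ (ρ / 2),
      φ p + ((s / 2 * ‖p - z‖ ^ 2 : ℝ) : EReal) ≤ φ u + ((s / 2 * ‖u - z‖ ^ 2 : ℝ) : EReal) :=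
    exists_add_coe_le_of_isCompact (isCompact_closedBall x₀ (ρ / 2)) ⟨x₀, hx₀⟩
      (H.lowerSemicontinuousOn.mono hsub) (by fun_prop)
  choose P hPmem hPle using hmin
  have htop (z : E) : φ (P z) ≠ ⊤ := by
    intro htop
    have hle := hPle z x₀ hx₀
    rw [htop, EReal.top_add_coe, top_le_iff] at hle
    exact EReal.add_ne_top H.zero_mem.1 (EReal.coe_ne_top _) hle
  have hnorm (z : E) : ‖P z - x₀‖ ≤ 3 * ‖z - x₀‖ :=
    H.norm_sub_le_three_mul hs (hsub (hPmem z)) (htop z) (hPle z x₀ hx₀)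
  have hball : ∀ z ∈ Metric.ball x₀ (min (ρ / 6) (ρ / (4 * s))), P z ∈ Metric.ball x₀ (ρ / 2) := by
    intro z hz
    rw [mem_ball_iff_norm, lt_min_iff] at hz
    rw [mem_ball_iff_norm]
    linarith [hnorm z]
  refine ⟨min (ρ / 6) (ρ / (4 * s)), by positivity, P, hball, fun z hz => ⟨hsub (hPmem z), ?_, ?_⟩,
    fun z _ => hPle z⟩
  · rw [mem_ball_iff_norm, lt_min_iff, lt_div_iff₀ (b := ρ) (c := 4 * s) (by positivity)]
      at hz
    rw [mem_ball_zero_iff, norm_smul, Real.norm_of_nonneg hs.le]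
    have htri : ‖z - P z‖ ≤ 4 * ‖z - x₀‖ := by
      linarith [norm_sub_le_norm_sub_add_norm_sub z x₀ (P z), hnorm z, norm_sub_rev x₀ (P z)]
    linarith [mul_le_mul_of_nonneg_left htri hs.le]
  · exact regularSubdiff_subset_limitingSubdiff _ _ (smul_sub_mem_regularSubdiff (htop z)
      (H.ne_bot (hsub (hPmem z))) (eventually_of_mem (Metric.isOpen_ball.mem_nhds (hball z hz))
        fun u hu => hPle z u (Metric.ball_subset_closedBall hu)))

theorem UniformSubgradientInequality.norm_sub_le_two_mul
    (H : UniformSubgradientInequality φ x₀ ρ (-(s / 4))) (hs : 0 < s) {x₁ x₂ z₁ z₂ : E}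
    (h₁ : (x₁, s • (z₁ - x₁)) ∈ localSubdiffGraph φ x₀ ρ)
    (h₂ : (x₂, s • (z₂ - x₂)) ∈ localSubdiffGraph φ x₀ ρ) : ‖x₁ - x₂‖ ≤ 2 * ‖z₁ - z₂‖ := by
  have hmono := H.mul_norm_sq_le_inner h₁ h₂
  rw [← smul_sub, sub_sub_sub_comm, real_inner_smul_left, inner_sub_left,
    real_inner_self_eq_norm_sq] at hmono
  have hcs := real_inner_le_norm (z₁ - z₂) (x₁ - x₂)
  have hsq : 3 * ‖x₁ - x₂‖ ^ 2 ≤ 4 * (‖z₁ - z₂‖ * ‖x₁ - x₂‖) := by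
    refine le_of_mul_le_mul_left ?_ hs
    nlinarith
  by_contra! hcon
  nlinarith [norm_nonneg (x₁ - x₂), norm_nonneg (z₁ - z₂)]

namespace IsLocalProxMap

theorem lipschitzOnWith (hP : IsLocalProxMap φ x₀ ρ s δ P)
    (H : UniformSubgradientInequality φ x₀ ρ (-(s / 4))) (hs : 0 < s) :
    LipschitzOnWith 2 P (Metric.ball x₀ δ) :=
  LipschitzOnWith.of_dist_le_mul fun y hy z hz => by
    simpa [dist_eq_norm] using H.norm_sub_le_two_mul hs (hP.mem y hy) (hP.mem z hz)

theorem apply_add_smul (hP : IsLocalProxMap φ x₀ ρ s δ P)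
    (H : UniformSubgradientInequality φ x₀ ρ (-(s / 4))) (hs : 0 < s)
    (hxv : (x, v) ∈ localSubdiffGraph φ x₀ ρ) (hz : x + s⁻¹ • v ∈ Metric.ball x₀ δ) :
    P (x + s⁻¹ • v) = x := by
  have hnorm := H.norm_sub_le_two_mul hs (z₂ := x + s⁻¹ • v) (hP.mem _ hz)
    (by rwa [add_sub_cancel_left, smul_inv_smul₀ hs.ne'])
  simpa [sub_eq_zero] using hnorm

theorem exists_tendsto_mem_graphicalDerivative [FiniteDimensional ℝ E]
    (hP : IsLocalProxMap φ x₀ ρ s δ P) (H : UniformSubgradientInequality φ x₀ ρ (-(s / 4)))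
    (hs : 0 < s) (hy : y ∈ Metric.ball x₀ δ) (h : E) :
    ∃ (ε : ℕ → ℝ) (w : E), Tendsto ε atTop (𝓝[>] 0) ∧
      Tendsto (fun j => (ε j)⁻¹ • (P (y + ε j • h) - P y)) atTop (𝓝 w) ∧
      s • (h - w) ∈ graphicalDerivative (limitingSubdiff φ) (P y) (s • (y - P y)) w := by
  have hev : ∀ᶠ ε : ℝ in 𝓝[>] 0, 0 < ε ∧ y + ε • h ∈ Metric.ball x₀ δ := by
    have hlim : Tendsto (fun ε : ℝ => y + ε • h) (𝓝 0) (𝓝 y) := by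
      simpa using (by fun_prop : Continuous fun ε : ℝ => y + ε • h).tendsto 0
    exact eventually_mem_nhdsWithin.and
      (nhdsWithin_le_nhds (hlim.eventually (Metric.isOpen_ball.mem_nhds hy)))
  obtain ⟨ε, hε, hεmem⟩ := exists_seq_forall_of_frequently hev.frequently
  have hbounded (j : ℕ) : (ε j)⁻¹ • (P (y + ε j • h) - P y) ∈
      Metric.closedBall (0 : E) (2 * ‖h‖) := by
    have hlip := (hP.lipschitzOnWith H hs).dist_le_mul _ (hεmem j).2 _ hy
    rw [dist_eq_norm, dist_self_add_left, norm_smul, Real.norm_of_nonneg (hεmem j).1.le] at hlip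
    rw [mem_closedBall_zero_iff, norm_smul, norm_inv, Real.norm_of_nonneg (hεmem j).1.le,
      inv_mul_le_iff₀ (hεmem j).1]
    push_cast at hlip
    linarith
  obtain ⟨w, -, κ, hκ, hw⟩ := tendsto_subseq_of_bounded Metric.isBounded_closedBall hbounded
  have hεκ := hε.comp hκ.tendsto_atTop
  refine ⟨ε ∘ κ, w, hεκ, hw, ε ∘ κ, _, _, fun j => (hεmem (κ j)).1,
    tendsto_nhds_of_tendsto_nhdsWithin hεκ, hw, (hw.const_sub h).const_smul s, fun j => ?_⟩
  have hmem := (hP.mem _ (hεmem (κ j)).2).2.2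
  have hne := (hεmem (κ j)).1.ne'
  simp only [Function.comp_apply]
  rw [smul_inv_smul₀ hne, add_sub_cancel, smul_comm (ε (κ j)) s, smul_sub (ε (κ j)),
    smul_inv_smul₀ hne, ← smul_add]
  convert hmem using 2
  abel

end IsLocalProxMap

theorem mul_norm_sq_le_inner_smul_sub {w : E} (hσ : 0 ≤ σ) (hs : 0 < s)
    (hw : σ * ‖w‖ ^ 2 ≤ inner ℝ (s • (h - w)) w) :
    σ * s / (σ + s) * ‖h‖ ^ 2 ≤ inner ℝ (s • (h - w)) h := by
  have hsplit : inner ℝ (s • (h - w)) h = inner ℝ (s • (h - w)) w + s * ‖h - w‖ ^ 2 := by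
    rw [← real_inner_self_eq_norm_sq, ← real_inner_smul_left, ← inner_add_right, add_sub_cancel]
  have hnorm : ‖h‖ ^ 2 = ‖w‖ ^ 2 + 2 * inner ℝ w (h - w) + ‖h - w‖ ^ 2 := by
    rw [← norm_add_sq_real, add_sub_cancel]
  have hsq : 0 ≤ ‖σ • w - s • (h - w)‖ ^ 2 := by positivity
  rw [norm_sub_sq_real, norm_smul, norm_smul, mul_pow, mul_pow, Real.norm_eq_abs,
    Real.norm_eq_abs, sq_abs, sq_abs, real_inner_smul_left, real_inner_smul_right] at hsq
  have hconv : σ * s / (σ + s) * ‖h‖ ^ 2 ≤ σ * ‖w‖ ^ 2 + s * ‖h - w‖ ^ 2 := by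
    rw [div_mul_eq_mul_div, div_le_iff₀ (by positivity), hnorm]
    nlinarith
  linarith

namespace IsLocalProxMap

variable [FiniteDimensional ℝ E]

theorem frequently_lt_slope (hP : IsLocalProxMap φ x₀ ρ s δ P)
    (H : UniformSubgradientInequality φ x₀ ρ (-(s / 4))) (hs : 0 < s) (hσ : 0 ≤ σ)
    (hD : ∀ p ∈ localSubdiffGraph φ x₀ ρ, ∀ w,
      ∀ q ∈ graphicalDerivative (limitingSubdiff φ) p.1 p.2 w, σ * ‖w‖ ^ 2 ≤ inner ℝ q w)
    {τ R : ℝ} (hz : z + τ • h ∈ Metric.ball x₀ δ) (hR : R < σ * s / (σ + s) * ‖h‖ ^ 2) :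
    ∃ᶠ b in 𝓝[>] τ,
      R < slope (fun t : ℝ => inner ℝ (s • (z + t • h - P (z + t • h))) h) τ b := by
  obtain ⟨ε, w, hε, hw, hq⟩ := hP.exists_tendsto_mem_graphicalDerivative H hs hz h
  obtain ⟨hε₀, hεpos⟩ := tendsto_nhdsWithin_iff.1 hε
  have hto : Tendsto (fun j => τ + ε j) atTop (𝓝[>] τ) :=
    tendsto_nhdsWithin_iff.2 ⟨by simpa using hε₀.const_add τ,
      hεpos.mono fun j hj => lt_add_of_pos_right τ hj⟩
  have hlim : Tendsto (fun j => inner ℝ (s • (h - (ε j)⁻¹ •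
      (P (z + τ • h + ε j • h) - P (z + τ • h)))) h) atTop (𝓝 (inner ℝ (s • (h - w)) h)) :=
    ((hw.const_sub h).const_smul s).inner tendsto_const_nhds
  have hbound := mul_norm_sq_le_inner_smul_sub hσ hs (hD _ (hP.mem _ hz) w _ hq)
  refine hto.frequently (Eventually.frequently ?_)
  filter_upwards [hlim.eventually (lt_mem_nhds (hR.trans_le hbound)), hεpos] with j hj hpos
  refine hj.trans_eq ?_
  have hne : ε j ≠ 0 := ne_of_gt hpos
  rw [slope_def_field, add_sub_cancel_left, ← inner_sub_left, div_eq_inv_mul,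
    ← real_inner_smul_left, add_smul, ← add_assoc]
  congr 1
  match_scalars <;> field_simp <;> ring

/-- The gradient `z ↦ s • (z - P z)` of the Moreau envelope is strongly monotone. -/
theorem inner_add_le_inner (hP : IsLocalProxMap φ x₀ ρ s δ P)
    (H : UniformSubgradientInequality φ x₀ ρ (-(s / 4))) (hs : 0 < s) (hσ : 0 ≤ σ)
    (hD : ∀ p ∈ localSubdiffGraph φ x₀ ρ, ∀ w,
      ∀ q ∈ graphicalDerivative (limitingSubdiff φ) p.1 p.2 w, σ * ‖w‖ ^ 2 ≤ inner ℝ q w)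
    (hz : ∀ τ ∈ Set.Icc (0 : ℝ) 1, z + τ • h ∈ Metric.ball x₀ δ) {t : ℝ}
    (ht : t ∈ Set.Icc (0 : ℝ) 1) :
    inner ℝ (s • (z - P z)) h + σ * s / (σ + s) * ‖h‖ ^ 2 * t ≤
      inner ℝ (s • (z + t • h - P (z + t • h))) h := by
  have hPcont : ContinuousOn (fun τ : ℝ => P (z + τ • h)) (Set.Icc 0 1) :=
    (hP.lipschitzOnWith H hs).continuousOn.comp (by fun_prop) hz
  have hcont : ContinuousOn (fun τ : ℝ => inner ℝ (s • (z + τ • h - P (z + τ • h))) h)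
      (Set.Icc 0 1) :=
    (((by fun_prop : Continuous fun τ : ℝ => z + τ • h).continuousOn.sub hPcont).const_smul s).inner
      continuousOn_const
  have hle := add_mul_le_of_frequently_lt_slope hcont
    (fun τ hτ R hR => hP.frequently_lt_slope H hs hσ hD (hz τ (Set.Ico_subset_Icc_self hτ)) hR) ht
  simpa using hle

end IsLocalProxMap

/-- The Moreau envelope `z ↦ inf_u (φ u + s / 2 * ‖u - z‖ ^ 2)` of `φ`, localized around a
reference point: the infimum is written as the value at the point `P z` attaining it. -/
noncomputable def moreauEnvelope (φ : E → EReal) (s : ℝ) (P : E → E) (z : E) : ℝ :=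
  (φ (P z)).toReal + s / 2 * ‖P z - z‖ ^ 2

namespace IsLocalProxMap

theorem moreauEnvelope_sub_le (hP : IsLocalProxMap φ x₀ ρ s δ P) (hz : z ∈ Metric.ball x₀ δ)
    (hu : u ∈ Metric.closedBall x₀ (ρ / 2)) :
    ((moreauEnvelope φ s P z - s / 2 * ‖u - z‖ ^ 2 : ℝ) : EReal) ≤ φ u := by
  have hle := hP.le z hz u hu
  obtain ⟨-, -, htop, hbot, -⟩ := hP.mem z hz
  rw [add_coe_le_add_coe_iff, ← EReal.coe_toReal htop hbot, ← EReal.coe_add, ← add_sub_assoc]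
    at hle
  exact hle

theorem moreauEnvelope_add_inner_sub_le (hP : IsLocalProxMap φ x₀ ρ s δ P)
    (hy : y ∈ Metric.ball x₀ δ) (hz : z ∈ Metric.ball x₀ δ) :
    moreauEnvelope φ s P y + inner ℝ (s • (z - P z)) (z - y) - s / 2 * ‖z - y‖ ^ 2 ≤
      moreauEnvelope φ s P z := by
  have hle := hP.moreauEnvelope_sub_le hy (Metric.ball_subset_closedBall (hP.mem_ball z hz))
  obtain ⟨-, -, htop, hbot, -⟩ := hP.mem z hz
  rw [← EReal.coe_toReal htop hbot, EReal.coe_le_coe_iff, ← sub_add_sub_cancel (P z) z y,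
    norm_add_sq_real, ← neg_sub z (P z), inner_neg_left, norm_neg] at hle
  have henv : moreauEnvelope φ s P z = (φ (P z)).toReal + s / 2 * ‖z - P z‖ ^ 2 := by
    rw [moreauEnvelope, norm_sub_rev]
  rw [henv, real_inner_smul_left]
  linarith

variable [FiniteDimensional ℝ E]

theorem moreauEnvelope_add_le (hP : IsLocalProxMap φ x₀ ρ s δ P)
    (H : UniformSubgradientInequality φ x₀ ρ (-(s / 4))) (hs : 0 < s) (hσ : 0 ≤ σ)
    (hD : ∀ p ∈ localSubdiffGraph φ x₀ ρ, ∀ w,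
      ∀ q ∈ graphicalDerivative (limitingSubdiff φ) p.1 p.2 w, σ * ‖w‖ ^ 2 ≤ inner ℝ q w)
    (hz : z ∈ Metric.ball x₀ δ) (hzh : z + h ∈ Metric.ball x₀ δ) :
    moreauEnvelope φ s P z + inner ℝ (s • (z - P z)) h + σ * s / (σ + s) / 2 * ‖h‖ ^ 2 ≤
      moreauEnvelope φ s P (z + h) := by
  have hseg : ∀ τ ∈ Set.Icc (0 : ℝ) 1, z + τ • h ∈ Metric.ball x₀ δ := fun τ hτ => by
    simpa using (convex_ball x₀ δ).add_smul_sub_mem hz hzh hτ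
  set K := inner ℝ (s • (z - P z)) h
  set μ := σ * s / (σ + s)
  have hmono := le_of_forall_sub_sq_le
    (G := fun t => moreauEnvelope φ s P (z + t • h) - K * t - μ * ‖h‖ ^ 2 / 2 * t ^ 2)
    (c := s / 2 * ‖h‖ ^ 2 - μ * ‖h‖ ^ 2 / 2) fun a b ha hab hb => ?_
  · norm_num at hmono
    linarith
  · have hle := hP.moreauEnvelope_add_inner_sub_le (hseg a ⟨ha, hab.trans hb⟩)
      (hseg b ⟨ha.trans hab, hb⟩)
    rw [add_sub_add_left_eq_sub, ← sub_smul, real_inner_smul_right, norm_smul, mul_pow,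
      Real.norm_eq_abs, sq_abs] at hle
    have hgrad := mul_le_mul_of_nonneg_left
      (hP.inner_add_le_inner H hs hσ hD hseg ⟨ha.trans hab, hb⟩) (sub_nonneg.2 hab)
    linarith

/-- The strong convexity inequality of the envelope is evaluated at `z = x + s⁻¹ v`, where
`P z = x`, in the direction which makes the modulus `σ s / (σ + s)` of the envelope return the
modulus `σ` for `φ`. -/
theorem add_inner_add_le (hP : IsLocalProxMap φ x₀ ρ s δ P)
    (H : UniformSubgradientInequality φ x₀ ρ (-(s / 4))) (hs : 0 < s) (hσ : 0 ≤ σ)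
    (hD : ∀ p ∈ localSubdiffGraph φ x₀ ρ, ∀ w,
      ∀ q ∈ graphicalDerivative (limitingSubdiff φ) p.1 p.2 w, σ * ‖w‖ ^ 2 ≤ inner ℝ q w)
    (hxv : (x, v) ∈ localSubdiffGraph φ x₀ ρ) (hz : x + s⁻¹ • v ∈ Metric.ball x₀ δ)
    (hzh : x + s⁻¹ • v + ((σ + s) / s) • (u - x) ∈ Metric.ball x₀ δ)
    (hu : u ∈ Metric.closedBall x₀ (ρ / 2)) :
    φ x + ((inner ℝ v (u - x) + σ / 2 * ‖u - x‖ ^ 2 : ℝ) : EReal) ≤ φ u := by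
  refine le_trans ?_ (hP.moreauEnvelope_sub_le hzh hu)
  have henv := hP.moreauEnvelope_add_le H hs hσ hD hz hzh
  rw [moreauEnvelope, hP.apply_add_smul H hs hxv hz, add_sub_cancel_left,
    smul_inv_smul₀ hs.ne', sub_add_cancel_left, norm_neg, real_inner_smul_right, norm_smul,
    norm_smul, mul_pow, mul_pow, Real.norm_eq_abs, Real.norm_eq_abs, sq_abs, sq_abs] at henv
  rw [← EReal.coe_toReal hxv.2.2.1 hxv.2.2.2.1, ← EReal.coe_add, EReal.coe_le_coe_iff]
  have hdist : u - (x + s⁻¹ • v + ((σ + s) / s) • (u - x)) =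
      -(s⁻¹ • (v + σ • (u - x))) := by
    match_scalars <;> field_simp <;> ring
  rw [hdist, norm_neg, norm_smul, mul_pow, Real.norm_eq_abs, sq_abs, norm_add_sq_real,
    real_inner_smul_right, norm_smul, mul_pow, Real.norm_eq_abs, sq_abs]
  refine le_trans (le_of_eq ?_) (sub_le_sub_right henv _)
  field_simp
  ring

end IsLocalProxMap

theorem UniformSubgradientInequality.exists_of_graphicalDerivative [FiniteDimensional ℝ E]
    (H : UniformSubgradientInequality φ x₀ ρ (-(s / 4))) (hs : 0 < s) (hσ : 0 ≤ σ)
    (hD : ∀ᶠ p : E × E in 𝓝 (x₀, 0), ∀ w,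
      ∀ q ∈ graphicalDerivative (limitingSubdiff φ) p.1 p.2 w, σ * ‖w‖ ^ 2 ≤ inner ℝ q w) :
    ∃ η, UniformSubgradientInequality φ x₀ η σ := by
  obtain ⟨ρ₁, hρ₁, hD⟩ := Metric.eventually_nhds_iff_ball.1 hD
  have hρ := lt_min H.radius_pos hρ₁
  replace H := H.mono hρ (min_le_left ρ ρ₁) le_rfl
  replace hD : ∀ p ∈ localSubdiffGraph φ x₀ (min ρ ρ₁), ∀ w,
      ∀ q ∈ graphicalDerivative (limitingSubdiff φ) p.1 p.2 w, σ * ‖w‖ ^ 2 ≤ inner ℝ q w := by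
    refine fun p hp => hD p (Metric.ball_subset_ball (min_le_right ρ ρ₁) ?_)
    rw [← ball_prod_same]
    exact ⟨hp.1, hp.2.1⟩
  obtain ⟨δ, hδ, P, hP⟩ := H.exists_isLocalProxMap hs
  have hnear {k : (E × E) × E → E} {c : E} {r : ℝ} (hk : Continuous k)
      (hc : k ((x₀, 0), x₀) = c) (hr : 0 < r) :
      ∀ᶠ q in 𝓝 ((x₀, 0), x₀), k q ∈ Metric.ball c r :=
    hk.continuousAt.eventually_mem (hc ▸ Metric.ball_mem_nhds _ hr)
  refine exists_uniformSubgradientInequality_of_eventually H.zero_mem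
    (eventually_of_mem (Metric.ball_mem_nhds x₀ hρ) H.lowerSemicontinuousAt) ?_
  filter_upwards [hnear (c := x₀) continuous_fst.fst rfl hρ,
    hnear (c := 0) continuous_fst.snd rfl hρ, hnear (c := x₀) continuous_snd rfl (half_pos hρ),
    hnear (k := fun q : (E × E) × E => q.1.1 + s⁻¹ • q.1.2) (c := x₀) (by fun_prop) (by simp) hδ,
    hnear (k := fun q : (E × E) × E => q.1.1 + s⁻¹ • q.1.2 + ((σ + s) / s) • (q.2 - q.1.1))
      (c := x₀) (by fun_prop) (by simp) hδ] with q hx hv hu hz hzh hxv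
  exact hP.add_inner_add_le H hs hσ hD ⟨hx, hv, hxv⟩ hz hzh (Metric.ball_subset_closedBall hu)

end ProximalMap

section QuadraticHull

variable {E : Type*} [NormedAddCommGroup E] [InnerProductSpace ℝ E] {φ : E → EReal}
  {x₀ u : E} {p : E × E} {ρ σ : ℝ} {U : Set E}

theorem ConvexOnWithModulus.biSup {ι : Type*} {T : Set ι} {ψ : ι → E → EReal}
    (h : ∀ i ∈ T, ConvexOnWithModulus U σ (ψ i)) :
    ConvexOnWithModulus U σ fun x => ⨆ i ∈ T, ψ i x := by
  intro x hx y hy a b ha hb hab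
  rw [← EReal.le_sub_iff_add_le (.inl (EReal.coe_ne_bot _)) (.inl (EReal.coe_ne_top _))]
  refine iSup₂_le fun i hi => ?_
  rw [EReal.le_sub_iff_add_le (.inl (EReal.coe_ne_bot _)) (.inl (EReal.coe_ne_top _))]
  refine (h i hi x hx y hy a b ha hb hab).trans ?_
  gcongr <;> exact le_iSup₂ (f := fun j (_ : j ∈ T) => ψ j _) i hi

theorem convexOnWithModulus_quadratic (c σ : ℝ) (x v : E) (U : Set E) :
    ConvexOnWithModulus U σ fun u =>
      ((c + (inner ℝ v (u - x) + σ / 2 * ‖u - x‖ ^ 2) : ℝ) : EReal) := by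
  refine convexOnWithModulus_coe fun y _ z _ a b _ _ hab => le_of_eq ?_
  obtain rfl : b = 1 - a := by linarith
  have hcomb : a • y + (1 - a) • z - x = a • (y - x) + (1 - a) • (z - x) := by module
  rw [hcomb, ← sub_sub_sub_cancel_right y z x, norm_add_sq_real, norm_sub_sq_real, inner_add_right]
  simp only [norm_smul, mul_pow, Real.norm_eq_abs, sq_abs, real_inner_smul_left,
    real_inner_smul_right]
  ring

/-- The supremum of the quadratic minorants of modulus `σ` generated by the subgradient pairs of
`φ` in `localSubdiffGraph φ x₀ ρ`; it serves as the function `ψ` in the definition of variational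
convexity. -/
noncomputable def quadraticHull (φ : E → EReal) (x₀ : E) (ρ σ : ℝ) (u : E) : EReal :=
  ⨆ p ∈ localSubdiffGraph φ x₀ ρ,
    φ p.1 + ((inner ℝ p.2 (u - p.1) + σ / 2 * ‖u - p.1‖ ^ 2 : ℝ) : EReal)

theorem add_coe_le_quadraticHull (hp : p ∈ localSubdiffGraph φ x₀ ρ) (u : E) :
    φ p.1 + ((inner ℝ p.2 (u - p.1) + σ / 2 * ‖u - p.1‖ ^ 2 : ℝ) : EReal) ≤
      quadraticHull φ x₀ ρ σ u :=
  le_iSup₂ (f := fun (p : E × E) (_ : p ∈ localSubdiffGraph φ x₀ ρ) =>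
    φ p.1 + ((inner ℝ p.2 (u - p.1) + σ / 2 * ‖u - p.1‖ ^ 2 : ℝ) : EReal)) p hp

theorem lowerSemicontinuous_quadraticHull : LowerSemicontinuous (quadraticHull φ x₀ ρ σ) := by
  refine lowerSemicontinuous_biSup fun p _ => Continuous.lowerSemicontinuous ?_
  refine continuous_iff_continuousAt.2 fun u =>
    (EReal.continuousAt_add (.inr (EReal.coe_ne_bot _)) (.inr (EReal.coe_ne_top _))).comp
      (continuousAt_const.prodMk (continuous_coe_real_ereal.comp ?_).continuousAt)
  fun_prop

theorem convexOnWithModulus_quadraticHull (U : Set E) :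
    ConvexOnWithModulus U σ (quadraticHull φ x₀ ρ σ) := by
  refine ConvexOnWithModulus.biSup fun p hp => ?_
  rw [← EReal.coe_toReal hp.2.2.1 hp.2.2.2.1]
  exact_mod_cast convexOnWithModulus_quadratic (φ p.1).toReal σ p.1 p.2 U

namespace UniformSubgradientInequality

theorem quadraticHull_le (H : UniformSubgradientInequality φ x₀ ρ σ)
    (hu : u ∈ Metric.ball x₀ ρ) : quadraticHull φ x₀ ρ σ u ≤ φ u :=
  iSup₂_le fun p hp => H.le p hp u hu

theorem quadraticHull_eq (H : UniformSubgradientInequality φ x₀ ρ σ)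
    (hp : p ∈ localSubdiffGraph φ x₀ ρ) : quadraticHull φ x₀ ρ σ p.1 = φ p.1 :=
  (H.quadraticHull_le hp.1).antisymm (by simpa using add_coe_le_quadraticHull (σ := σ) hp p.1)

theorem quadraticHull_ne_bot (H : UniformSubgradientInequality φ x₀ ρ σ) (u : E) :
    quadraticHull φ x₀ ρ σ u ≠ ⊥ := by
  have hle := add_coe_le_quadraticHull (σ := σ) H.mem_localSubdiffGraph u
  lift φ x₀ to ℝ using ⟨H.zero_mem.1, H.zero_mem.2.1⟩ with c
  exact ((EReal.bot_lt_coe _).trans_le hle).ne'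

theorem mem_limitingSubdiff_quadraticHull (H : UniformSubgradientInequality φ x₀ ρ σ)
    (hσ : 0 ≤ σ) (hp : p ∈ localSubdiffGraph φ x₀ ρ) :
    p.2 ∈ limitingSubdiff (quadraticHull φ x₀ ρ σ) p.1 := by
  have heq := H.quadraticHull_eq hp
  refine regularSubdiff_subset_limitingSubdiff _ _ (mem_regularSubdiff_of_eventually_le (c := 0)
    (heq ▸ hp.2.2.1) (heq ▸ hp.2.2.2.1) (Eventually.of_forall fun u => ?_))
  refine le_trans ?_ (add_coe_le_quadraticHull hp u)
  rw [heq]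
  refine add_le_add_right (EReal.coe_le_coe_iff.2 ?_) _
  have hsq : 0 ≤ σ / 2 * ‖u - p.1‖ ^ 2 := by positivity
  linarith

theorem eventually_mem_localSubdiffGraph [FiniteDimensional ℝ E]
    (H : UniformSubgradientInequality φ x₀ ρ σ) (hσ : 0 ≤ σ) :
    ∀ᶠ p : E × E in 𝓝 (x₀, 0), p.2 ∈ limitingSubdiff (quadraticHull φ x₀ ρ σ) p.1 →
      p ∈ localSubdiffGraph φ x₀ ρ := by
  obtain ⟨δ, hδ, P, hP⟩ := (H.mono H.radius_pos le_rfl (σ' := -(1 / 4))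
    (by linarith)).exists_isLocalProxMap one_pos
  have hsum : Tendsto (fun p : E × E => p.1 + p.2) (𝓝 (x₀, 0)) (𝓝 x₀) := by
    simpa using (continuous_add (M := E)).tendsto (x₀, 0)
  filter_upwards [hsum.eventually (Metric.ball_mem_nhds x₀ hδ)] with ⟨x, v⟩ hz hxv
  -- `(P (x + v), x + v - P (x + v))` is another pair in the graph of the monotone map `∂ψ`,
  -- and the sum of its components is `x + v` as well.
  have hmem := hP.mem _ hz
  rw [one_smul] at hmem
  have hmono := ((convexOnWithModulus_quadraticHull Set.univ).anti subset_rfl hσ).inner_sub_nonneg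
    H.quadraticHull_ne_bot hxv (H.mem_limitingSubdiff_quadraticHull hσ hmem)
  have hneg : v - (x + v - P (x + v)) = -(x - P (x + v)) := by abel
  rw [hneg, inner_neg_left, real_inner_self_eq_norm_sq, neg_nonneg] at hmono
  have hPx : x = P (x + v) := by
    rw [← sub_eq_zero, ← norm_eq_zero]
    exact pow_eq_zero_iff two_ne_zero |>.1 (hmono.antisymm (sq_nonneg _))
  rwa [← hPx, add_sub_cancel_left] at hmem

theorem eventually_lt_add (H : UniformSubgradientInequality φ x₀ ρ σ) (hσ : 0 ≤ σ) {ε : ℝ}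
    (hε : 0 < ε) :
    ∀ᶠ p : E × E in 𝓝 (x₀, 0), p ∈ localSubdiffGraph φ x₀ ρ → φ p.1 < φ x₀ + (ε : EReal) := by
  have hlim : Tendsto (fun p : E × E => -inner ℝ p.2 (x₀ - p.1)) (𝓝 (x₀, 0)) (𝓝 0) := by
    simpa using (by fun_prop :
      Continuous fun p : E × E => -inner ℝ p.2 (x₀ - p.1)).tendsto (x₀, 0)
  filter_upwards [hlim.eventually (gt_mem_nhds hε)] with p hsmall hp
  have hle := H.toReal_add_le hp (Metric.mem_ball_self H.radius_pos) H.zero_mem.1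
  have hsq : 0 ≤ σ / 2 * ‖x₀ - p.1‖ ^ 2 := by positivity
  rw [← EReal.coe_toReal hp.2.2.1 hp.2.2.2.1, ← EReal.coe_toReal H.zero_mem.1 H.zero_mem.2.1]
  norm_cast
  linarith

theorem variationallyConvexWithModulus [FiniteDimensional ℝ E]
    (H : UniformSubgradientInequality φ x₀ ρ σ) (hσ : 0 ≤ σ) :
    VariationallyConvexWithModulus φ x₀ 0 σ := by
  have hρ : ∀ᶠ p : E × E in 𝓝 (x₀, 0), p ∈ Metric.ball (x₀, 0) ρ :=
    Metric.ball_mem_nhds _ H.radius_pos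
  obtain ⟨θ, hθ, hnear⟩ := Metric.eventually_nhds_iff_ball.1
    (hρ.and ((H.eventually_mem_localSubdiffGraph hσ).and (H.eventually_lt_add hσ one_pos)))
  simp only [← ball_prod_same, Set.mem_prod, and_imp, Prod.forall] at hnear
  have hball : Metric.ball x₀ θ ⊆ Metric.ball x₀ ρ := fun x hx =>
    (hnear x 0 hx (Metric.mem_ball_self hθ)).1.1
  have hiff : ∀ x ∈ Metric.ball x₀ θ, ∀ v ∈ Metric.ball (0 : E) θ,
      (φ x < φ x₀ + ((1 : ℝ) : EReal) ∧ v ∈ limitingSubdiff φ x) ↔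
        v ∈ limitingSubdiff (quadraticHull φ x₀ ρ σ) x := by
    intro x hx v hv
    obtain ⟨⟨hxρ, hvρ⟩, hgraph, hlt⟩ := hnear x v hx hv
    exact ⟨fun h => H.mem_limitingSubdiff_quadraticHull (p := (x, v)) hσ ⟨hxρ, hvρ, h.2⟩,
      fun hψ => ⟨hlt (hgraph hψ), (hgraph hψ).2.2⟩⟩
  have heq : ∀ x ∈ Metric.ball x₀ θ, ∀ v ∈ Metric.ball (0 : E) θ,
      v ∈ limitingSubdiff (quadraticHull φ x₀ ρ σ) x → φ x = quadraticHull φ x₀ ρ σ x :=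
    fun x hx v hv hψ => (H.quadraticHull_eq ((hnear x v hx hv).2.1 hψ)).symm
  exact ⟨H.zero_mem, _, Metric.ball_mem_nhds _ hθ, _, Metric.ball_mem_nhds _ hθ,
    convex_ball _ _, convex_ball _ _, H.lowerSemicontinuousOn.mono hball,
    quadraticHull φ x₀ ρ σ, H.quadraticHull_ne_bot, lowerSemicontinuous_quadraticHull,
    (convexOnWithModulus_quadraticHull _).anti subset_rfl hσ, convexOnWithModulus_quadraticHull _,
    fun x hx => H.quadraticHull_le (hball hx), 1, one_pos, hiff, heq⟩

end UniformSubgradientInequality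

end QuadraticHull

section TiltStability

variable {E : Type*} [NormedAddCommGroup E] [InnerProductSpace ℝ E] {φ : E → EReal}
  {x₀ x v : E} {ρ σ γ : ℝ}

theorem mem_tiltArgmin_iff : x ∈ tiltArgmin φ x₀ γ v ↔ x ∈ Metric.closedBall x₀ γ ∧
    ∀ u ∈ Metric.closedBall x₀ γ, φ x + ((inner ℝ v (u - x) : ℝ) : EReal) ≤ φ u := by
  refine and_congr_right fun _ => forall₂_congr fun u _ => ?_
  rw [sub_eq_add_neg, sub_eq_add_neg, ← EReal.coe_neg, ← EReal.coe_neg, add_coe_le_add_coe_iff,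
    inner_sub_right, neg_sub_neg]

theorem tiltArgmin_nonempty [FiniteDimensional ℝ E] (hγ : 0 ≤ γ)
    (hφ : LowerSemicontinuousOn φ (Metric.closedBall x₀ γ)) (v : E) :
    (tiltArgmin φ x₀ γ v).Nonempty := by
  obtain ⟨x, hx, hmin⟩ := exists_add_coe_le_of_isCompact (h := fun u => -inner ℝ v u)
    (isCompact_closedBall x₀ γ) ⟨x₀, Metric.mem_closedBall_self hγ⟩ hφ (by fun_prop)
  refine ⟨x, hx, fun u hu => ?_⟩
  rw [sub_eq_add_neg, sub_eq_add_neg, ← EReal.coe_neg, ← EReal.coe_neg]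
  exact hmin u hu

namespace UniformSubgradientInequality

theorem isStrongLocalMinimizer (H : UniformSubgradientInequality φ x₀ ρ σ) (hσ : 0 < σ) :
    IsStrongLocalMinimizer φ x₀ σ :=
  ⟨hσ, H.zero_mem.1, eventually_of_mem (Metric.ball_mem_nhds x₀ H.radius_pos)
    fun _ hu => H.base_add_le hu⟩

theorem ne_top_and_mul_norm_sub_le_of_mem_tiltArgmin (H : UniformSubgradientInequality φ x₀ ρ σ)
    (hγ : γ < ρ) (hx : x ∈ tiltArgmin φ x₀ γ v) : φ x ≠ ⊤ ∧ σ * ‖x - x₀‖ ≤ 2 * ‖v‖ := by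
  obtain ⟨hxγ, hmin⟩ := mem_tiltArgmin_iff.1 hx
  have hxρ := Metric.closedBall_subset_ball hγ hxγ
  have hle := hmin x₀ (Metric.mem_closedBall_self (Metric.nonneg_of_mem_closedBall hxγ))
  have hbase := H.base_add_le hxρ
  have htop : φ x ≠ ⊤ := by
    intro htop
    rw [htop, EReal.top_add_coe, top_le_iff] at hle
    exact H.zero_mem.1 hle
  refine ⟨htop, ?_⟩
  lift φ x to ℝ using ⟨htop, H.ne_bot hxρ⟩ with a
  lift φ x₀ to ℝ using ⟨H.zero_mem.1, H.zero_mem.2.1⟩ with b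
  norm_cast at hle hbase
  have hcs := real_inner_le_norm v (x - x₀)
  rw [← neg_sub x x₀, inner_neg_right] at hle
  obtain hzero | hpos := (norm_nonneg (x - x₀)).eq_or_lt
  · simp [← hzero]
  · exact le_of_mul_le_mul_right (by linarith) hpos

theorem mem_localSubdiffGraph_of_mem_tiltArgmin (H : UniformSubgradientInequality φ x₀ ρ σ)
    (hσ : 0 < σ) (hγ : γ < ρ) (hvρ : ‖v‖ < ρ) (hvγ : 2 * ‖v‖ < σ * γ)
    (hx : x ∈ tiltArgmin φ x₀ γ v) : (x, v) ∈ localSubdiffGraph φ x₀ ρ := by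
  obtain ⟨hxγ, hmin⟩ := mem_tiltArgmin_iff.1 hx
  have hxρ := Metric.closedBall_subset_ball hγ hxγ
  obtain ⟨htop, hnorm⟩ := H.ne_top_and_mul_norm_sub_le_of_mem_tiltArgmin hγ hx
  have hinterior : x ∈ Metric.ball x₀ γ :=
    mem_ball_iff_norm.2 (lt_of_mul_lt_mul_left (hnorm.trans_lt hvγ) hσ.le)
  refine ⟨hxρ, mem_ball_zero_iff.2 hvρ, regularSubdiff_subset_limitingSubdiff _ _
    (mem_regularSubdiff_of_eventually_le (c := 0) htop (H.ne_bot hxρ)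
      (eventually_of_mem (Metric.isOpen_ball.mem_nhds hinterior) fun u hu => ?_))⟩
  simpa using hmin u (Metric.ball_subset_closedBall hu)

theorem norm_sub_le_inv_mul (H : UniformSubgradientInequality φ x₀ ρ σ) (hσ : 0 < σ)
    {x₁ x₂ v₁ v₂ : E} (h₁ : (x₁, v₁) ∈ localSubdiffGraph φ x₀ ρ)
    (h₂ : (x₂, v₂) ∈ localSubdiffGraph φ x₀ ρ) : ‖x₁ - x₂‖ ≤ σ⁻¹ * ‖v₁ - v₂‖ := by
  have hmono := (H.mul_norm_sq_le_inner h₁ h₂).trans (real_inner_le_norm _ _)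
  rw [le_inv_mul_iff₀ hσ]
  by_contra! hcon
  nlinarith [norm_nonneg (x₁ - x₂), norm_nonneg (v₁ - v₂)]

theorem isTiltStableLocalMinimizer [FiniteDimensional ℝ E]
    (H : UniformSubgradientInequality φ x₀ ρ σ) (hσ : 0 < σ) :
    IsTiltStableLocalMinimizer φ x₀ σ⁻¹ := by
  have hρ := H.radius_pos
  have hγ : ρ / 2 < ρ := half_lt_self hρ
  choose m hm using tiltArgmin_nonempty (half_pos hρ).le
    (H.lowerSemicontinuousOn.mono (Metric.closedBall_subset_ball hγ))
  have hgraph : ∀ v ∈ Metric.ball (0 : E) (min ρ (σ * ρ / 4)), ∀ x ∈ tiltArgmin φ x₀ (ρ / 2) v,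
      (x, v) ∈ localSubdiffGraph φ x₀ ρ := by
    intro v hv x hx
    obtain ⟨hvρ, hvσ⟩ := lt_min_iff.1 (mem_ball_zero_iff.1 hv)
    exact H.mem_localSubdiffGraph_of_mem_tiltArgmin hσ hγ hvρ (by linarith) hx
  have hunique : ∀ v ∈ Metric.ball (0 : E) (min ρ (σ * ρ / 4)), ∀ x,
      (x, v) ∈ localSubdiffGraph φ x₀ ρ → x = m v := fun v hv x hx => by
    simpa [sub_eq_zero] using H.norm_sub_le_inv_mul hσ hx (hgraph v hv _ (hm v))
  have hsingleton : ∀ v ∈ Metric.ball (0 : E) (min ρ (σ * ρ / 4)),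
      tiltArgmin φ x₀ (ρ / 2) v = {m v} := fun v hv =>
    Set.eq_singleton_iff_unique_mem.2 ⟨hm v, fun x hx => hunique v hv x (hgraph v hv x hx)⟩
  have hzero := Metric.mem_ball_self (x := (0 : E)) (show 0 < min ρ (σ * ρ / 4) by positivity)
  refine ⟨by positivity, H.zero_mem.1, ρ / 2, half_pos hρ, ?_, _,
    Metric.isOpen_ball.mem_nhds hzero, m, hsingleton, fun v₁ hv₁ v₂ hv₂ =>
      H.norm_sub_le_inv_mul hσ (hgraph v₁ hv₁ _ (hm v₁)) (hgraph v₂ hv₂ _ (hm v₂))⟩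
  rw [hsingleton 0 hzero, ← hunique 0 hzero x₀ H.mem_localSubdiffGraph]

end UniformSubgradientInequality

end TiltStability

theorem UniformSubgradientInequality.isLocalMinOn {E F : Type*} [NormedAddCommGroup E]
    [InnerProductSpace ℝ E] {f : E → ℝ} {g : E → F} {Θ : Set F} {x₀ : E} {ρ : ℝ}
    (H : UniformSubgradientInequality (constrainedCost f g Θ) x₀ ρ 0) (hx₀ : x₀ ∈ feasibleSet g Θ) :
    IsLocalMinOn f (feasibleSet g Θ) x₀ := by
  refine eventually_nhdsWithin_iff.2
    (eventually_of_mem (Metric.ball_mem_nhds x₀ H.radius_pos) fun u hu huΓ => ?_)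
  have hle := H.base_add_le hu
  rw [constrainedCost_of_mem (show g x₀ ∈ Θ from hx₀),
    constrainedCost_of_mem (show g u ∈ Θ from huΓ)] at hle
  simpa using hle

section SecondOrderSufficiency

variable {E F : Type*} [NormedAddCommGroup E] [InnerProductSpace ℝ E] [FiniteDimensional ℝ E]
  [NormedAddCommGroup F] [InnerProductSpace ℝ F] [FiniteDimensional ℝ F]
  {f : E → ℝ} {g : E → F} {Θ : Set F} {x₀ : E} {σ : ℝ}

theorem SecondOrderCondition.exists_uniformSubgradientInequality
    (h : SecondOrderCondition f g Θ x₀ σ) (hσ : 0 ≤ σ) (hΘ : Convex ℝ Θ) (hcl : IsClosed Θ)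
    (hf : ContDiffAt ℝ 2 f x₀) (hg : ContDiffAt ℝ 2 g x₀)
    (hfirst : FirstOrderCondition f g Θ x₀) (hM : MSCQ g Θ x₀) :
    ∃ ρ, UniformSubgradientInequality (constrainedCost f g Θ) x₀ ρ σ := by
  obtain ⟨s, hs, ρ, H⟩ := exists_uniformSubgradientInequality_neg hΘ hcl hf hg hfirst hM
  have hweak : UniformSubgradientInequality (constrainedCost f g Θ) x₀ ρ (-(4 * (s + 1) / 4)) :=
    H.mono H.radius_pos le_rfl (by linarith)
  exact hweak.exists_of_graphicalDerivative (by positivity) hσ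
    (h.eventually_le_inner hM hΘ hcl hf hg)

theorem theorem8p3_general (hΘ : Convex ℝ Θ) (hcl : IsClosed Θ)
    (hf : ContDiffAt ℝ 2 f x₀) (hg : ContDiffAt ℝ 2 g x₀)
    (hfirst : FirstOrderCondition f g Θ x₀) (hMSCQ : MSCQ g Θ x₀) :
    (SecondOrderCondition f g Θ x₀ 0 →
      VariationallyConvex (constrainedCost f g Θ) x₀ 0 ∧
      (x₀ ∈ feasibleSet g Θ ∧ IsLocalMinOn f (feasibleSet g Θ) x₀)) ∧
    (∀ σ : ℝ, 0 < σ → SecondOrderCondition f g Θ x₀ σ →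
      StronglyVariationallyConvex (constrainedCost f g Θ) x₀ 0 σ ∧
      IsStrongLocalMinimizer (constrainedCost f g Θ) x₀ σ ∧
      IsTiltStableLocalMinimizer (constrainedCost f g Θ) x₀ σ⁻¹) := by
  refine ⟨fun h => ?_, fun σ hσ h => ?_⟩
  · obtain ⟨ρ, H⟩ := h.exists_uniformSubgradientInequality le_rfl hΘ hcl hf hg hfirst hMSCQ
    exact ⟨H.variationallyConvexWithModulus le_rfl, hMSCQ.1, H.isLocalMinOn hMSCQ.1⟩
  · obtain ⟨ρ, H⟩ := h.exists_uniformSubgradientInequality hσ.le hΘ hcl hf hg hfirst hMSCQ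
    exact ⟨⟨hσ, H.variationallyConvexWithModulus hσ.le⟩, H.isStrongLocalMinimizer hσ,
      H.isTiltStableLocalMinimizer hσ⟩

end SecondOrderSufficiency

end VariationalAnalysis

open VariationalAnalysis in
theorem theorem8p3 {n m : ℕ}
    (f : EuclideanSpace ℝ (Fin n) → ℝ)
    (g : EuclideanSpace ℝ (Fin n) → EuclideanSpace ℝ (Fin m))
    (Θ : Set (EuclideanSpace ℝ (Fin m))) (hΘ : IsConvexPolyhedron Θ)
    (xbar : EuclideanSpace ℝ (Fin n))
    (hf : ContDiffAt ℝ 2 f xbar) (hg : ContDiffAt ℝ 2 g xbar)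
    (hfirst : FirstOrderCondition f g Θ xbar)
    (hMSCQ : MSCQ g Θ xbar) :
    (SecondOrderCondition f g Θ xbar 0 →
      VariationallyConvex (constrainedCost f g Θ) xbar 0 ∧
      (xbar ∈ feasibleSet g Θ ∧ IsLocalMinOn f (feasibleSet g Θ) xbar)) ∧
    (∀ σ : ℝ, 0 < σ → SecondOrderCondition f g Θ xbar σ →
      StronglyVariationallyConvex (constrainedCost f g Θ) xbar 0 σ ∧
      IsStrongLocalMinimizer (constrainedCost f g Θ) xbar σ ∧
      IsTiltStableLocalMinimizer (constrainedCost f g Θ) xbar σ⁻¹) :=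
  theorem8p3_general hΘ.convex hΘ.isClosed hf hg hfirst hMSCQ
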